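/- Let $a_1,a_2>0$ be real numbers and let $S^3\subset\mathbb C^2$ be the unit sphere, with coordinates $z_i=x^i+\sqrt{-1}\,y^i$. Put $\sigma=a_1|z_1|^2+a_2|z_2|^2$ and let $\eta_a=\sigma^{-1}\sum_{i=1}^2(x^i\,dy^i-y^i\,dx^i)$, restricted to $S^3$. Let $\xi_a$ be its Reeb vector field, determined by $\eta_a(\xi_a)=1$ and $d\eta_a(\xi_a,\cdot)=0$; let $\phi_a$ be the endomorphism of $TS^3$ with $\phi_a\xi_a=0$ which is the complex structure of $\mathbb C^2$ on $\ker\eta_a$; and let $g_a=d\eta_a\circ(\mathrm{Id}\otimes\phi_a)+\eta_a\otimes\eta_a$. Here the exterior derivative of a one-form is normalized by $2\,d\alpha(X,Y)=X(\alpha(Y))-Y(\alpha(X))-\alpha([X,Y])$, so that $g_a$ is the round metric of the unit sphere when $a_1=a_2=1$. Let $\mathcal F_{\xi_a}$ be the foliation of $S^3$ whose leaves are tangent to $\xi_a$, $\mathcal L$ its tangent line bundle, $\pi:TS^3\to\nu=TS^3/\mathcal L$ the quotient map, $s\mapsto Y_s$ the identification $\nu\cong\mathcal L^\perp$ defined by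 $g_a$, and $g_a^T(s,t)=g_a(Y_s,Y_t)$ the transverse metric on $\nu$. Let $\nabla$ be the transverse Levi-Civita connection on $\nu$: $\nabla_Xs=\pi[X,Y_s]$ for $X$ tangent to $\mathcal L$ and $\nabla_Xs=\pi(\nabla^{g_a}_XY_s)$ for $X$ orthogonal to $\mathcal L$, where $\nabla^{g_a}$ is the Levi-Civita connection of $g_a$. Let $R(X,Y)s=\nabla_X\nabla_Ys-\nabla_Y\nabla_Xs-\nabla_{[X,Y]}s$, and let the transverse scalar curvature be $$R^T=\sum_{i,j=1}^2 g_a^T\big(R(e_j,e_i)\pi e_i,\ \pi e_j\big)$$ for any local orthonormal frame $(e_1,e_2)$ of $\mathcal L^\perp$ (the value does not depend on the frame). Then at every point of $S^3$ $$R^T=-24(a_1-a_2)^2\sigma^{-1}|z_1|^2|z_2|^2-16(a_1-a_2)\big(|z_1|^2-|z_2|^2\big)+8\sigma .$$ -/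

import Mathlib

open scoped Manifold ContDiff

noncomputable section

namespace RiemannianFoliation

/-! ### Transverse geometry of a Riemannian foliation

`M` is a manifold, `g` a Riemannian metric on `M`, given by its values `g x` on the tangent spaces,
and a foliation is given by its tangent distribution `L`. -/

variable {E : Type*} [NormedAddCommGroup E] [NormedSpace ℝ E]
  {H : Type*} [TopologicalSpace H] (I : ModelWithCorners ℝ E H)
  {M : Type*} [TopologicalSpace M] [ChartedSpace H M] [IsManifold I ∞ M]

/-- `cov` is a Levi-Civita connection of the metric `g`: a covariant derivative on the tangent
bundle that is torsion free and compatible with `g`.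
Here `cov Y x (X x)` is the value of `∇_X Y` at `x`. -/
structure IsLeviCivita (g : Π x : M, LinearMap.BilinForm ℝ (TangentSpace I x))
    (cov : (Π x : M, TangentSpace I x) → (Π x : M, TangentSpace I x →L[ℝ] TangentSpace I x)) :
    Prop where
  isCovariantDerivative :
    IsCovariantDerivativeOn (I := I) (V := (TangentSpace I : M → Type _)) E cov Set.univ
  torsion_free : ∀ (X Y : Π x : M, TangentSpace I x) (x : M),
    MDiffAt (T% X) x → MDiffAt (T% Y) x →
      cov Y x (X x) - cov X x (Y x) = VectorField.mlieBracket I X Y x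
  metric : ∀ (Y Z : Π x : M, TangentSpace I x) (x : M) (v : TangentSpace I x),
    MDiffAt (T% Y) x → MDiffAt (T% Z) x →
      mvfderiv I (fun y => g y (Y y) (Z y)) x v = g x (cov Y x v) (Z x) + g x (Y x) (cov Z x v)

/-- The Levi-Civita connection `∇^M` of `g`. It is unique on differentiable vector fields;
`leviCivita I g Y x (X x)` is the value of `∇^M_X Y` at `x`. -/
def leviCivita (g : Π x : M, LinearMap.BilinForm ℝ (TangentSpace I x)) :
    (Π x : M, TangentSpace I x) → (Π x : M, TangentSpace I x →L[ℝ] TangentSpace I x) :=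
  Classical.epsilon (IsLeviCivita I g)

variable (g : Π x : M, LinearMap.BilinForm ℝ (TangentSpace I x))
  (L : Π x : M, Submodule ℝ (TangentSpace I x))

/-- The quotient map `π` from the tangent bundle to the normal bundle `ν = TM / L`,
on vector fields. -/
def toNormal (X : Π x : M, TangentSpace I x) : Π x : M, TangentSpace I x ⧸ L x :=
  fun x => (L x).mkQ (X x)

/-- The splitting `σ : ν → L^⊥` of the quotient map: the representative of a normal vector that
is `g`-orthogonal to the leaf. -/
def normalLift (s : Π x : M, TangentSpace I x ⧸ L x) : Π x : M, TangentSpace I x :=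
  fun x => Classical.epsilon fun v : TangentSpace I x =>
    (L x).mkQ v = s x ∧ ∀ u ∈ L x, g x v u = 0

/-- The component of a vector field in `L^⊥`. -/
def horizontalPart (X : Π x : M, TangentSpace I x) : Π x : M, TangentSpace I x :=
  normalLift I g L (toNormal I L X)

/-- The component of a vector field in `L`. -/
def leafPart (X : Π x : M, TangentSpace I x) : Π x : M, TangentSpace I x :=
  X - horizontalPart I g L X

/-- The transverse metric `g^T(s, t) = g(σ s, σ t)` on the normal bundle. -/
def transverseMetric (s t : Π x : M, TangentSpace I x ⧸ L x) (x : M) : ℝ :=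
  g x (normalLift I g L s x) (normalLift I g L t x)

/-- The transverse Levi-Civita connection on the normal bundle: `∇_X s = π [X, σ s]` for `X`
tangent to the leaves and `∇_X s = π (∇^M_X (σ s))` for `X` orthogonal to the leaves. -/
def transverseConnection (X : Π x : M, TangentSpace I x) (s : Π x : M, TangentSpace I x ⧸ L x) :
    Π x : M, TangentSpace I x ⧸ L x :=
  fun x =>
    (L x).mkQ (VectorField.mlieBracket I (leafPart I g L X) (normalLift I g L s) x) +
    (L x).mkQ (leviCivita I g (normalLift I g L s) x (horizontalPart I g L X x))

/-- The transverse curvature operator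
`R^T(X, Y) s = ∇_X ∇_Y s - ∇_Y ∇_X s - ∇_{[X, Y]} s`. -/
def transverseCurvature (X Y : Π x : M, TangentSpace I x)
    (s : Π x : M, TangentSpace I x ⧸ L x) : Π x : M, TangentSpace I x ⧸ L x :=
  transverseConnection I g L X (transverseConnection I g L Y s) -
    transverseConnection I g L Y (transverseConnection I g L X s) -
    transverseConnection I g L (VectorField.mlieBracket I X Y) s

/-- `e` is a smooth local `g`-orthonormal frame of `L^⊥`, defined near `p`. -/
def IsOrthonormalNormalFrameAt {q : ℕ} (e : Fin q → Π x : M, TangentSpace I x) (p : M) : Prop :=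
  ∃ U : Set M, IsOpen U ∧ p ∈ U ∧
    (∀ i, ContMDiffOn I I.tangent ∞ (T% (e i)) U) ∧
    ∀ x ∈ U,
      (∀ i, ∀ u ∈ L x, g x (e i x) u = 0) ∧
      (∀ i j, g x (e i x) (e j x) = if i = j then 1 else 0) ∧
      (∀ v : TangentSpace I x, (∀ u ∈ L x, g x v u = 0) →
        v ∈ Submodule.span ℝ (Set.range fun i => e i x))

/-- The transverse Ricci curvature `Ric^T(X, Y) = ∑ i, g^T(R^T(X, e_i)(π e_i), π Y)`, computed in
the frame `e` of `L^⊥`. -/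
def transverseRicci {q : ℕ} (e : Fin q → Π x : M, TangentSpace I x)
    (X Y : Π x : M, TangentSpace I x) (x : M) : ℝ :=
  ∑ i, transverseMetric I g L
    (transverseCurvature I g L X (e i) (toNormal I L (e i))) (toNormal I L Y) x

/-- The transverse scalar curvature at `p` of the codimension `q` foliation with tangent
distribution `L` and bundle-like metric `g` is `R`: local orthonormal frames of `L^⊥` exist near
`p`, and each of them gives `∑ j, Ric^T(e_j, e_j) = R` at `p`. -/
def HasTransverseScalarCurvatureAt (q : ℕ) (p : M) (R : ℝ) : Prop :=
  (∃ e : Fin q → Π x : M, TangentSpace I x, IsOrthonormalNormalFrameAt I g L e p) ∧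
  ∀ e : Fin q → Π x : M, TangentSpace I x, IsOrthonormalNormalFrameAt I g L e p →
    ∑ j, transverseRicci I g L e (e j) (e j) p = R

end RiemannianFoliation

namespace WeightedSasakian

/-! ### The weighted Sasakian structure on the unit sphere of `ℂ²` -/

/-- `ℂ²` with its standard Euclidean structure. -/
abbrev C2 : Type := EuclideanSpace ℂ (Fin 2)

instance finrank_C2 : Fact (Module.finrank ℝ C2 = 3 + 1) := ⟨by
  rw [LinearEquiv.finrank_eq (WithLp.linearEquiv 2 ℝ (Fin 2 → ℂ))]
  simp [Module.finrank_pi_fintype]⟩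

/-- The unit sphere `S³` of `ℂ²`. -/
abbrev S3 : Type := Metric.sphere (0 : C2) 1

/-- The differential at `p` of the inclusion of `S³` in `ℂ²`. -/
def incl (p : S3) : TangentSpace (𝓡 3) p →L[ℝ] C2 :=
  mvfderiv (𝓡 3) (Subtype.val : S3 → C2) p

/-- The real coordinate one-form `dx^i` on `ℂ²`, where `z_i = x^i + √-1 y^i`. -/
def dx (i : Fin 2) : C2 →L[ℝ] ℝ :=
  Complex.reCLM ∘L (EuclideanSpace.proj i : C2 →L[ℂ] ℂ).restrictScalars ℝ

/-- The real coordinate one-form `dy^i` on `ℂ²`. -/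
def dy (i : Fin 2) : C2 →L[ℝ] ℝ :=
  Complex.imCLM ∘L (EuclideanSpace.proj i : C2 →L[ℂ] ℂ).restrictScalars ℝ

/-- The function `σ = a₁ |z₁|² + a₂ |z₂|²`. -/
def sigma (a : Fin 2 → ℝ) (z : C2) : ℝ := ∑ i, a i * ‖z i‖ ^ 2

/-- The one-form `σ⁻¹ ∑ i, (x^i dy^i - y^i dx^i)` on `ℂ² ∖ {0}`. -/
def contactForm (a : Fin 2 → ℝ) (z : C2) : C2 →L[ℝ] ℝ :=
  (sigma a z)⁻¹ • ∑ i, ((z i).re • dy i - (z i).im • dx i)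

/-- A continuous alternating two-form on `ℂ²` as a bilinear form. -/
def toBilinForm (f : C2 [⋀^Fin 2]→L[ℝ] ℝ) : LinearMap.BilinForm ℝ C2 :=
  LinearMap.mk₂ ℝ (fun u v => f ![u, v])
    (fun u u' v => f.toAlternatingMap.map_vecCons_add ![v] u u')
    (fun c u v => f.toAlternatingMap.map_vecCons_smul ![v] c u)
    (fun u v v' => by
      simpa using (f.toContinuousMultilinearMap.toMultilinearMap.curryLeft u).cons_add 0 v v')
    (fun c u v => by
      simpa using (f.toContinuousMultilinearMap.toMultilinearMap.curryLeft u).cons_smul 0 c v)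

/-- The exterior derivative of a one-form on `ℂ²`, as a bilinear form, with the normalization
`2 dα(X, Y) = X(α(Y)) - Y(α(X)) - α([X, Y])` usual in contact geometry.
With this convention the unweighted structure carries the round metric of the unit sphere. -/
def extDerivForm (α : C2 → C2 →L[ℝ] ℝ) (z : C2) : LinearMap.BilinForm ℝ C2 :=
  (1 / 2 : ℝ) • toBilinForm
    (extDeriv (fun w => ContinuousAlternatingMap.ofSubsingleton ℝ C2 ℝ (0 : Fin 1) (α w)) z)

/-- The contact form `η_a` on `S³`. -/
def eta (a : Fin 2 → ℝ) (p : S3) : TangentSpace (𝓡 3) p →L[ℝ] ℝ :=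
  contactForm a (p : C2) ∘L incl p

/-- The two-form `dη_a` on `S³`. -/
def dEta (a : Fin 2 → ℝ) (p : S3) : LinearMap.BilinForm ℝ (TangentSpace (𝓡 3) p) :=
  (extDerivForm (contactForm a) (p : C2)).compl₁₂ (incl p).toLinearMap (incl p).toLinearMap

/-- The Reeb vector field `ξ_a`, determined by `η_a(ξ_a) = 1` and `dη_a(ξ_a, ·) = 0`. -/
def reeb (a : Fin 2 → ℝ) (p : S3) : TangentSpace (𝓡 3) p :=
  Classical.epsilon fun ξ : TangentSpace (𝓡 3) p => eta a p ξ = 1 ∧ ∀ v, dEta a p ξ v = 0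

/-- The endomorphism `φ_a`, determined by `φ_a(ξ_a) = 0` and by being multiplication by `√-1`
on the contact distribution `ker η_a`. -/
def phi (a : Fin 2 → ℝ) (p : S3) : TangentSpace (𝓡 3) p →ₗ[ℝ] TangentSpace (𝓡 3) p :=
  Classical.epsilon fun φ : TangentSpace (𝓡 3) p →ₗ[ℝ] TangentSpace (𝓡 3) p =>
    φ (reeb a p) = 0 ∧ ∀ v, eta a p v = 0 → incl p (φ v) = Complex.I • incl p v

/-- The metric `g_a = dη_a ∘ (Id ⊗ φ_a) + η_a ⊗ η_a` on `S³`. -/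
def metric (a : Fin 2 → ℝ) (p : S3) : LinearMap.BilinForm ℝ (TangentSpace (𝓡 3) p) :=
  (dEta a p).compl₂ (phi a p) +
    (LinearMap.mul ℝ ℝ).compl₁₂ (eta a p).toLinearMap (eta a p).toLinearMap

/-- The tangent distribution of the characteristic foliation, spanned by `ξ_a`. -/
def leaves (a : Fin 2 → ℝ) (p : S3) : Submodule ℝ (TangentSpace (𝓡 3) p) :=
  Submodule.span ℝ {reeb a p}

end WeightedSasakian

end

/-! The normal bundle has rank two, so the transverse geometry is carried by one complex one-form.
Suppose that `g = η² + |Θ|²`, that the leaves are tangent to `ker Θ`, and that `dη = 2 Θ₁ ∧ Θ₂` and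
`dΘ = -√-1 α ∧ Θ` for a real form `α` (with `d` as in `formDeriv`, without the factor 1/2). Then `Θ`
trivializes `ν` as a complex line bundle, and in this trivialization the transverse connection is `d
+ √-1 α`. Along the leaves this is the equation for `dΘ`, read as a formula for `Θ [X, Y]`; across
them it is the `Θ` component of the explicit Levi-Civita connection `adaptedCov`. The curvature is
therefore `√-1 dα`, and if `dα = κ Θ₁ ∧ Θ₂` on `ker η`, contraction with an orthonormal frame gives
`-2κ`: this is `hasTransverseScalarCurvatureAt`.

On the weighted sphere, `η_a` is completed by `Θ = σ^(-1/2) χ`, where `χ = z₁ dz₂ - z₂ dz₁ + √-1 (a₁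
- a₂) z₁ z₂ η_a` vanishes on the Reeb field. Every vector tangent to the sphere is a real multiple
of the Reeb vector plus a complex multiple of `horVec z` (`eq_frameVec`). In these components the
structure equations are algebraic identities on `ℂ²` (`d_contactForm`, `d_thetaForm`,
`d_alphaForm`), and `formDeriv_restrictForm` carries them to `S³`.

The objects defined by choice (`leviCivita`, `normalLift`, `reeb`, `phi`) are pinned down by proving
existence and, as far as it is needed, uniqueness in terms of the coframe. -/

noncomputable section

/-! ### Lie brackets as commutators of derivations -/

section LieBracketDerivation

open Set Filter Topology VectorField

variable {E : Type*} [NormedAddCommGroup E] [NormedSpace ℝ E]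
  {H : Type*} [TopologicalSpace H] {I : ModelWithCorners ℝ E H}
  {M : Type*} [TopologicalSpace M] [ChartedSpace H M]
  {F : Type*} [NormedAddCommGroup F] [NormedSpace ℝ F]

/-- A function that is given near `y` by a differentiable function of the chart at `x`. -/
lemma hasMFDerivAt_of_eventuallyEq_comp_extChartAt [IsManifold I 1 M] {x y : M} {k : M → F}
    {k' : E → F} (hy : y ∈ (extChartAt I x).source) (h : k =ᶠ[𝓝 y] k' ∘ extChartAt I x)
    (hk : DifferentiableWithinAt ℝ k' (range I) (extChartAt I x y)) :
    MDiffAt k y ∧ ∀ v, mvfderiv I k y v =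
      fderivWithin ℝ k' (range I) (extChartAt I x y)
        (mfderiv I 𝓘(ℝ, E) (extChartAt I x) y v) := by
  have h1 : HasMFDerivWithinAt 𝓘(ℝ, E) 𝓘(ℝ, F) k' (range I) (extChartAt I x y)
      (fderivWithin ℝ k' (range I) (extChartAt I x y)) :=
    hk.hasFDerivWithinAt.hasMFDerivWithinAt
  have h2 : MDiffAt (extChartAt I x) y :=
    mdifferentiableAt_extChartAt (by simpa using hy)
  have h3 := h1.comp (s := univ) y h2.hasMFDerivAt.hasMFDerivWithinAt
    (fun z _ => by simp [extChartAt])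
  rw [hasMFDerivWithinAt_univ] at h3
  have h4 := h3.congr_of_eventuallyEq h
  refine ⟨h4.mdifferentiableAt, fun v => ?_⟩
  rw [mvfderiv, h4.mfderiv]
  rfl

lemma contDiffWithinAt_comp_extChartAt_symm {f : M → F} {x : M} (hf : CMDiffAt 2 f x) :
    ContDiffWithinAt ℝ 2 (f ∘ (extChartAt I x).symm) (range I) (extChartAt I x x) := by
  exact (contMDiffAt_iff.1 hf).2

variable [IsManifold I 2 M]

/-- Pulling back by the inverse chart is pushing forward by the chart, because the two derivatives
are mutually inverse. -/
lemma mfderiv_extChartAt_eq_mpullbackWithin {x y : M} (hy : y ∈ (extChartAt I x).source)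
    (W : Π x : M, TangentSpace I x) :
    mfderiv I 𝓘(ℝ, E) (extChartAt I x) y (W y) =
      mpullbackWithin 𝓘(ℝ, E) I (extChartAt I x).symm W (range I) (extChartAt I x y) := by
  have : IsManifold I 1 M := IsManifold.of_le (n := 2) one_le_two
  have key : ∀ u ∈ (extChartAt I x).target, mfderiv I 𝓘(ℝ, E) (extChartAt I x)
      ((extChartAt I x).symm u) (W ((extChartAt I x).symm u)) =
        mpullbackWithin 𝓘(ℝ, E) I (extChartAt I x).symm W (range I) u := by
    intro u hu
    rw [mpullbackWithin_apply, ContinuousLinearMap.inverse_eq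
      (mfderivWithin_extChartAt_symm_comp_mfderiv_extChartAt hu)
      (mfderiv_extChartAt_comp_mfderivWithin_extChartAt_symm hu)]
    rfl
  rw [← key _ ((extChartAt I x).map_source hy), (extChartAt I x).left_inv hy]

/-- In the chart at `x`, the derivative of `f` along `W` is that of the coordinate expressions. -/
lemma mvfderiv_apply_eventuallyEq {f : M → F} {x : M} (hf : CMDiffAt 2 f x)
    (W : Π x : M, TangentSpace I x) :
    (fun y => mvfderiv I f y (W y)) =ᶠ[𝓝 x]
      (fun u => fderivWithin ℝ (f ∘ (extChartAt I x).symm) (range I) u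
        (mpullbackWithin 𝓘(ℝ, E) I (extChartAt I x).symm W (range I) u)) ∘ extChartAt I x := by
  have : IsManifold I 1 M := IsManifold.of_le (n := 2) one_le_two
  have hd : ∀ᶠ y in 𝓝 x, DifferentiableWithinAt ℝ (f ∘ (extChartAt I x).symm) (range I)
      (extChartAt I x y) := by
    have h1 := (contDiffWithinAt_comp_extChartAt_symm hf).eventually (by simp)
    rw [insert_eq_of_mem (by simp [extChartAt])] at h1
    have h2 : Tendsto (extChartAt I x) (𝓝 x) (𝓝[range I] (extChartAt I x x)) :=
      tendsto_nhdsWithin_iff.2 ⟨continuousAt_extChartAt x,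
        Eventually.of_forall fun y => by simp [extChartAt]⟩
    exact (h2.eventually h1).mono fun y hy => hy.differentiableWithinAt two_ne_zero
  filter_upwards [hd, extChartAt_source_mem_nhds (I := I) x] with y hy hys
  rw [(hasMFDerivAt_of_eventuallyEq_comp_extChartAt hys ?_ hy).2,
    mfderiv_extChartAt_eq_mpullbackWithin hys]
  · rfl
  · filter_upwards [extChartAt_source_mem_nhds' (I := I) hys] with z hz
    rw [Function.comp_apply, Function.comp_apply, (extChartAt I x).left_inv hz]

variable [CompleteSpace E]

/-- One of the two orders of smoothness of `f` is spent on the derivative; the pairing of what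
remains with a differentiable field is differentiable. -/
lemma differentiableWithinAt_fderivWithin_mpullbackWithin {f : M → F} {x : M} (hf : CMDiffAt 2 f x)
    {W : Π x : M, TangentSpace I x} (hW : MDiffAt (T% W) x) :
    DifferentiableWithinAt ℝ (fun u => fderivWithin ℝ (f ∘ (extChartAt I x).symm) (range I) u
        (mpullbackWithin 𝓘(ℝ, E) I (extChartAt I x).symm W (range I) u)) (range I)
        (extChartAt I x x) := by
  have h1 := (contDiffWithinAt_comp_extChartAt_symm hf).fderivWithin_right (m := 1)
    I.uniqueDiffOn (by norm_num) (by simp [extChartAt])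
  have h2 := (mdifferentiableWithinAt_univ.2 hW).differentiableWithinAt_mpullbackWithin_vectorField
  rw [preimage_univ, univ_inter] at h2
  exact (h1.differentiableWithinAt one_ne_zero).clm_apply h2

/-- The derivative of a `C^2` function along a differentiable vector field is differentiable. -/
lemma MDifferentiableAt.mvfderiv_apply {f : M → F} {x : M} (hf : CMDiffAt 2 f x)
    {W : Π x : M, TangentSpace I x} (hW : MDiffAt (T% W) x) :
    MDiffAt (fun y => mvfderiv I f y (W y)) x := by
  have : IsManifold I 1 M := IsManifold.of_le (n := 2) one_le_two
  exact (hasMFDerivAt_of_eventuallyEq_comp_extChartAt (mem_extChartAt_source x)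
    (mvfderiv_apply_eventuallyEq hf W)
    (differentiableWithinAt_fderivWithin_mpullbackWithin hf hW)).1

/-- The derivative along a Lie bracket is the commutator of the derivatives. -/
theorem mvfderiv_mlieBracket {f : M → F} {x : M} (hf : CMDiffAt 2 f x)
    {V W : Π x : M, TangentSpace I x} (hV : MDiffAt (T% V) x) (hW : MDiffAt (T% W) x) :
    mvfderiv I f x (mlieBracket I V W x) =
      mvfderiv I (fun y => mvfderiv I f y (W y)) x (V x) -
        mvfderiv I (fun y => mvfderiv I f y (V y)) x (W x) := by
  have : IsManifold I 1 M := IsManifold.of_le (n := 2) one_le_two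
  have hd := fun (W : Π x : M, TangentSpace I x) (hW : MDiffAt (T% W) x) =>
    (hasMFDerivAt_of_eventuallyEq_comp_extChartAt (mem_extChartAt_source x)
    (mvfderiv_apply_eventuallyEq hf W)
    (differentiableWithinAt_fderivWithin_mpullbackWithin hf hW)).2
  have h2 := fun (W : Π x : M, TangentSpace I x) (hW : MDiffAt (T% W) x) =>
    (mdifferentiableWithinAt_univ.2 hW).differentiableWithinAt_mpullbackWithin_vectorField
  simp only [preimage_univ, univ_inter] at h2
  have hs := mem_extChartAt_source (I := I) x
  -- In the chart this is the vector space identity, where the second derivatives cancel by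
  -- symmetry.
  rw [hd V hV, hd W hW, mfderiv_extChartAt_eq_mpullbackWithin hs,
    mfderiv_extChartAt_eq_mpullbackWithin hs,
    ← fderivWithin_apply_lieBracket (n := 2) (contDiffWithinAt_comp_extChartAt_symm hf)
      (by simp) I.uniqueDiffOn (I.range_subset_closure_interior (by simp [extChartAt]))
      (by simp [extChartAt]) (h2 W hW) (h2 V hV)]
  have hk := (hasMFDerivAt_of_eventuallyEq_comp_extChartAt (k := f)
    (k' := f ∘ (extChartAt I x).symm) hs ?_
    ((contDiffWithinAt_comp_extChartAt_symm hf).differentiableWithinAt two_ne_zero)).2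
  · rw [hk, ← mlieBracketWithin_univ, mlieBracketWithin_apply, preimage_univ, univ_inter]
    congr 1
    -- The manifold bracket is the chart bracket pulled back by the inverse of the chart derivative,
    -- which cancels here.
    exact ((isInvertible_mfderiv_extChartAt hs).self_apply_inverse _)
  · filter_upwards [extChartAt_source_mem_nhds (I := I) x] with z hz
    rw [Function.comp_apply, Function.comp_apply, (extChartAt I x).left_inv hz]

end LieBracketDerivation

namespace RiemannianFoliation

/-! ### Foliations of codimension two with an adapted coframe -/

section AdaptedCoframe

open Set Filter Topology VectorField

variable {E : Type*} [NormedAddCommGroup E] [NormedSpace ℝ E]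
  {H : Type*} [TopologicalSpace H] {I : ModelWithCorners ℝ E H}
  {M : Type*} [TopologicalSpace M] [ChartedSpace H M]
  {F : Type*} [NormedAddCommGroup F] [NormedSpace ℝ F]
  {F' : Type*} [NormedAddCommGroup F'] [NormedSpace ℝ F']

lemma mvfderiv_clm_comp (A : F →L[ℝ] F') {h : M → F} {x : M} (hh : MDiffAt h x)
    (v : TangentSpace I x) :
    mvfderiv I (fun y => A (h y)) x v = A (mvfderiv I h x v) := by
  have := (A.hasMFDerivAt (x := h x)).comp x hh.hasMFDerivAt
  rw [mvfderiv]
  change NormedSpace.fromTangentSpace _ (mfderiv I 𝓘(ℝ, F') (A ∘ h) x v) = _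
  rw [this.mfderiv]
  rfl

lemma _root_.MDifferentiableAt.clm_comp_fun (A : F →L[ℝ] F') {h : M → F} {x : M}
    (hh : MDiffAt h x) : MDiffAt (fun y => A (h y)) x :=
  A.mdifferentiableAt.comp x hh

variable [IsManifold I ∞ M]

/-- The standard area form of `ℂ`. -/
def area (z w : ℂ) : ℝ := z.re * w.im - z.im * w.re

/-- A one-form that is smooth on smooth vector fields and differentiable on differentiable
ones. -/
structure IsSmoothForm (β : Π x : M, TangentSpace I x →L[ℝ] F) : Prop where
  mdifferentiableAt : ∀ (Y : Π x : M, TangentSpace I x) (x : M), MDiffAt (T% Y) x →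
    MDiffAt (fun y => β y (Y y)) x
  contMDiffAt : ∀ (Y : Π x : M, TangentSpace I x) (x : M), CMDiffAt ∞ (T% Y) x →
    CMDiffAt ∞ (fun y => β y (Y y)) x

/-- The exterior derivative `X (β Y) - Y (β X) - β [X, Y]` of a one-form. -/
def formDeriv (β : Π x : M, TangentSpace I x →L[ℝ] F) (X Y : Π x : M, TangentSpace I x) (x : M) :
    F :=
  mvfderiv I (fun y => β y (Y y)) x (X x) - mvfderiv I (fun y => β y (X y)) x (Y x) -
    β x (mlieBracket I X Y x)

/-- The vector field with components `a` and `c` in the frame `(ξ, e, f)`, where the span of `e`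
and `f` is identified with `ℂ`. -/
def frameField (ξ e f : Π x : M, TangentSpace I x) (a : M → ℝ) (c : M → ℂ) :
    Π x : M, TangentSpace I x :=
  a • ξ + (fun x => (c x).re) • e + (fun x => (c x).im) • f

/-- A coframe `(η, Θ)` adapted to a foliation by curves with leaves `ker Θ` and metric
`g = η² + |Θ|²`, with dual frame `(ξ, e, f)`, whose structure equations are
`dη = 2 Θ₁ ∧ Θ₂`, `dΘ = -√-1 α ∧ Θ` and, on `ker η`, `dα = κ Θ₁ ∧ Θ₂`. -/
structure IsAdaptedCoframe (g : Π x : M, LinearMap.BilinForm ℝ (TangentSpace I x))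
    (L : Π x : M, Submodule ℝ (TangentSpace I x)) (ξ e f : Π x : M, TangentSpace I x)
    (η : Π x : M, TangentSpace I x →L[ℝ] ℝ) (Θ : Π x : M, TangentSpace I x →L[ℝ] ℂ)
    (α : Π x : M, TangentSpace I x →L[ℝ] ℝ) (κ : M → ℝ) : Prop where
  contMDiff_xi : CMDiff ∞ (T% ξ)
  contMDiff_e : CMDiff ∞ (T% e)
  contMDiff_f : CMDiff ∞ (T% f)
  eta_smooth : IsSmoothForm η
  theta_smooth : IsSmoothForm Θ
  alpha_smooth : IsSmoothForm α
  eta_xi : ∀ x, η x (ξ x) = 1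
  eta_e : ∀ x, η x (e x) = 0
  eta_f : ∀ x, η x (f x) = 0
  theta_xi : ∀ x, Θ x (ξ x) = 0
  theta_e : ∀ x, Θ x (e x) = 1
  theta_f : ∀ x, Θ x (f x) = Complex.I
  eq_of_forms : ∀ x (u v : TangentSpace I x), η x u = η x v → Θ x u = Θ x v → u = v
  metric_apply : ∀ x (u v : TangentSpace I x),
    g x u v = η x u * η x v + ((Θ x u).re * (Θ x v).re + (Θ x u).im * (Θ x v).im)
  mem_leaf : ∀ x (u : TangentSpace I x), u ∈ L x ↔ Θ x u = 0
  d_eta : ∀ (X Y : Π x : M, TangentSpace I x) (x : M), MDiffAt (T% X) x → MDiffAt (T% Y) x →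
    formDeriv η X Y x = 2 * area (Θ x (X x)) (Θ x (Y x))
  d_theta : ∀ (X Y : Π x : M, TangentSpace I x) (x : M), MDiffAt (T% X) x → MDiffAt (T% Y) x →
    formDeriv Θ X Y x =
      -Complex.I * (α x (X x) * Θ x (Y x) - α x (Y x) * Θ x (X x))
  d_alpha : ∀ (X Y : Π x : M, TangentSpace I x) (x : M), MDiffAt (T% X) x → MDiffAt (T% Y) x →
    η x (X x) = 0 → η x (Y x) = 0 →
    formDeriv α X Y x = κ x * area (Θ x (X x)) (Θ x (Y x))

/-- The difference of the two connections, paired with a third field, is symmetric in two of its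
arguments (torsion) and skew in two others (metric), so it vanishes by the usual braid of
permutations. Tensoriality is not invoked: each tangent vector is extended once to a differentiable
field, and all identities are evaluated on these fields. -/
lemma IsLeviCivita.apply_eq
    {g : Π x : M, LinearMap.BilinForm ℝ (TangentSpace I x)}
    {cov cov' : (Π x : M, TangentSpace I x) → (Π x : M, TangentSpace I x →L[ℝ] TangentSpace I x)}
    (h : IsLeviCivita I g cov) (h' : IsLeviCivita I g cov')
    (hsymm : ∀ x u v, g x u v = g x v u)
    (hnondeg : ∀ x u, (∀ v, g x u v = 0) → u = 0)
    (hext : ∀ x (v : TangentSpace I x), ∃ X : Π x : M, TangentSpace I x, MDiffAt (T% X) x ∧ X x = v)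
    {Y : Π x : M, TangentSpace I x} {x : M} (hY : MDiffAt (T% Y) x) : cov Y x = cov' Y x := by
  have hD : ∀ X Y : Π x : M, TangentSpace I x, MDiffAt (T% X) x → MDiffAt (T% Y) x →
      (cov Y x - cov' Y x) (X x) = (cov X x - cov' X x) (Y x) := by
    intro X Y hX hY
    have h1 := h.torsion_free X Y x hX hY
    rw [← h'.torsion_free X Y x hX hY] at h1
    simp only [sub_apply]
    rw [sub_eq_sub_iff_add_eq_add] at h1 ⊢
    rw [h1, add_comm]
  have hM : ∀ (Y Z : Π x : M, TangentSpace I x) (v : TangentSpace I x),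
      MDiffAt (T% Y) x → MDiffAt (T% Z) x →
      g x ((cov Y x - cov' Y x) v) (Z x) = - g x ((cov Z x - cov' Z x) v) (Y x) := by
    intro Y Z v hY hZ
    have h1 := h.metric Y Z x v hY hZ
    rw [h'.metric Y Z x v hY hZ] at h1
    simp only [sub_apply, map_sub, LinearMap.sub_apply]
    rw [hsymm x (cov Z x v), hsymm x (cov' Z x v)]
    linarith
  ext v
  obtain ⟨X, hX, rfl⟩ := hext x v
  rw [← sub_eq_zero, ← sub_apply]
  refine hnondeg x _ fun w => ?_
  obtain ⟨Z, hZ, rfl⟩ := hext x w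
  have e1 := hM Y Z (X x) hY hZ
  have e2 := hM X Z (Y x) hX hZ
  have e3 := hM Y X (Z x) hY hX
  rw [hD X Y hX hY] at *
  rw [hD X Z hX hZ] at e1
  rw [hD Y Z hY hZ] at e2
  linarith

namespace IsAdaptedCoframe

variable {g : Π x : M, LinearMap.BilinForm ℝ (TangentSpace I x)}
  {L : Π x : M, Submodule ℝ (TangentSpace I x)} {ξ e f : Π x : M, TangentSpace I x}
  {η : Π x : M, TangentSpace I x →L[ℝ] ℝ} {Θ : Π x : M, TangentSpace I x →L[ℝ] ℂ}
  {α : Π x : M, TangentSpace I x →L[ℝ] ℝ} {κ : M → ℝ}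
  (h : IsAdaptedCoframe g L ξ e f η Θ α κ)

include h

lemma eta_frameField (a : M → ℝ) (c : M → ℂ) (x : M) : η x (frameField ξ e f a c x) = a x := by
  simp [frameField, h.eta_xi, h.eta_e, h.eta_f]

lemma theta_frameField (a : M → ℝ) (c : M → ℂ) (x : M) : Θ x (frameField ξ e f a c x) = c x := by
  simp [frameField, h.theta_xi, h.theta_e, h.theta_f, Complex.re_add_im]

lemma mdifferentiableAt_frameField {a : M → ℝ} {c : M → ℂ} {x : M} (ha : MDiffAt a x)
    (hc : MDifferentiableAt I 𝓘(ℝ, ℂ) c x) : MDiffAt (T% (frameField ξ e f a c)) x := by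
  have h1 := h.contMDiff_xi.contMDiffAt.mdifferentiableAt (x := x) (by simp)
  have h2 := h.contMDiff_e.contMDiffAt.mdifferentiableAt (x := x) (by simp)
  have h3 := h.contMDiff_f.contMDiffAt.mdifferentiableAt (x := x) (by simp)
  exact mdifferentiableAt_add_section (mdifferentiableAt_add_section (ha.smul_section h1)
    ((hc.clm_comp_fun Complex.reCLM).smul_section h2))
    ((hc.clm_comp_fun Complex.imCLM).smul_section h3)

lemma metric_symm (x : M) (u v : TangentSpace I x) : g x u v = g x v u := by
  rw [h.metric_apply, h.metric_apply]
  ring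

lemma eq_zero_of_metric (x : M) (u : TangentSpace I x) (hu : ∀ v, g x u v = 0) : u = 0 := by
  have h1 := hu u
  rw [h.metric_apply] at h1
  refine h.eq_of_forms x u 0 ?_ ?_
  · rw [map_zero]
    nlinarith [sq_nonneg (η x u), sq_nonneg (Θ x u).re, sq_nonneg (Θ x u).im]
  · rw [map_zero]
    apply Complex.ext
    · rw [Complex.zero_re]
      nlinarith [sq_nonneg (η x u), sq_nonneg (Θ x u).re, sq_nonneg (Θ x u).im]
    · rw [Complex.zero_im]
      nlinarith [sq_nonneg (η x u), sq_nonneg (Θ x u).re, sq_nonneg (Θ x u).im]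

/-- The frame is global, so constant coefficients suffice and no cutoff is involved. -/
lemma exists_field_eq (x : M) (v : TangentSpace I x) :
    ∃ X : Π x : M, TangentSpace I x, MDiffAt (T% X) x ∧ X x = v := by
  refine ⟨frameField ξ e f (fun _ => η x v) (fun _ => Θ x v),
    h.mdifferentiableAt_frameField mdifferentiableAt_const mdifferentiableAt_const, ?_⟩
  exact h.eq_of_forms x _ _ (h.eta_frameField _ _ x) (h.theta_frameField _ _ x)

/-! #### The Levi-Civita connection -/

omit h in
/-- The `η` component of the Levi-Civita connection. -/
def covEta (η : Π x : M, TangentSpace I x →L[ℝ] ℝ) (Θ : Π x : M, TangentSpace I x →L[ℝ] ℂ)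
    (Y : Π x : M, TangentSpace I x) (x : M) : TangentSpace I x →L[ℝ] ℝ :=
  mvfderiv I (fun y => η y (Y y)) x -
    ((Θ x (Y x)).im • Complex.reCLM ∘L Θ x - (Θ x (Y x)).re • Complex.imCLM ∘L Θ x)

omit h in
/-- The `Θ` component of the Levi-Civita connection. -/
def covTheta (η : Π x : M, TangentSpace I x →L[ℝ] ℝ) (Θ : Π x : M, TangentSpace I x →L[ℝ] ℂ)
    (α : Π x : M, TangentSpace I x →L[ℝ] ℝ)
    (Y : Π x : M, TangentSpace I x) (x : M) : TangentSpace I x →L[ℝ] ℂ :=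
  mvfderiv I (fun y => Θ y (Y y)) x + (α x).smulRight (Complex.I * Θ x (Y x)) +
    (η x).smulRight (Complex.I * Θ x (Y x)) + (Complex.I * η x (Y x)) • Θ x

omit h in
/-- The Levi-Civita connection in terms of an adapted coframe. -/
def adaptedCov (ξ e f : Π x : M, TangentSpace I x)
    (η : Π x : M, TangentSpace I x →L[ℝ] ℝ) (Θ : Π x : M, TangentSpace I x →L[ℝ] ℂ)
    (α : Π x : M, TangentSpace I x →L[ℝ] ℝ)
    (Y : Π x : M, TangentSpace I x) (x : M) : TangentSpace I x →L[ℝ] TangentSpace I x :=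
  (covEta η Θ Y x).smulRight (ξ x) + (Complex.reCLM ∘L covTheta η Θ α Y x).smulRight (e x) +
    (Complex.imCLM ∘L covTheta η Θ α Y x).smulRight (f x)

lemma eta_adaptedCov (Y : Π x : M, TangentSpace I x) (x : M) (v : TangentSpace I x) :
    η x (adaptedCov ξ e f η Θ α Y x v) =
      mvfderiv I (fun y => η y (Y y)) x v - area (Θ x v) (Θ x (Y x)) := by
  simp [adaptedCov, covEta, area, h.eta_xi, h.eta_e, h.eta_f]
  ring

lemma theta_adaptedCov (Y : Π x : M, TangentSpace I x) (x : M) (v : TangentSpace I x) :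
    Θ x (adaptedCov ξ e f η Θ α Y x v) =
      mvfderiv I (fun y => Θ y (Y y)) x v + Complex.I * (α x v * Θ x (Y x) + η x v * Θ x (Y x) +
        η x (Y x) * Θ x v) := by
  have : Θ x (adaptedCov ξ e f η Θ α Y x v) = covTheta η Θ α Y x v := by
    simp only [adaptedCov, add_apply, ContinuousLinearMap.smulRight_apply, map_add,
      map_smul, h.theta_xi, h.theta_e, h.theta_f]
    simp [Complex.re_add_im]
  rw [this]
  simp [covTheta]
  ring

omit h in
lemma isSmoothForm_mvfderiv_add {β : Π x : M, TangentSpace I x →L[ℝ] F} (hβ : IsSmoothForm β)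
    {Y Z : Π x : M, TangentSpace I x} {x : M} (hY : MDiffAt (T% Y) x) (hZ : MDiffAt (T% Z) x) :
    mvfderiv I (fun y => β y ((Y + Z) y)) x =
      mvfderiv I (fun y => β y (Y y)) x + mvfderiv I (fun y => β y (Z y)) x := by
  rw [← mvfderiv_add (hβ.mdifferentiableAt Y x hY) (hβ.mdifferentiableAt Z x hZ)]
  congr 1
  ext y
  simp

omit h in
lemma isSmoothForm_mvfderiv_smul {β : Π x : M, TangentSpace I x →L[ℝ] F} (hβ : IsSmoothForm β)
    {a : M → ℝ} {Y : Π x : M, TangentSpace I x} {x : M} (ha : MDiffAt a x)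
    (hY : MDiffAt (T% Y) x) (v : TangentSpace I x) :
    mvfderiv I (fun y => β y ((a • Y) y)) x v =
      a x • mvfderiv I (fun y => β y (Y y)) x v + mvfderiv I a x v • β x (Y x) := by
  have := mvfderiv_smul ha (hβ.mdifferentiableAt Y x hY)
  have h2 : (fun y => β y ((a • Y) y)) = a • fun y => β y (Y y) := by
    ext y
    simp
  rw [h2, this]
  simp

/-- Antisymmetrizing the `area` term gives `dη`, and antisymmetrizing the `α` term gives `dΘ`. The
remaining term `√-1 (η(v) Θ(Y) + η(Y) Θ(v))` is symmetric, hence invisible to torsion. Its second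
summand balances the `area` term in the metric equation; the other terms rotate `Θ(Y)` and so
preserve the metric. -/
lemma isLeviCivita : IsLeviCivita I g (adaptedCov ξ e f η Θ α) where
  isCovariantDerivative :=
    { add := by
        intro Y Z x hY hZ _
        ext v
        apply h.eq_of_forms
        · simp only [add_apply, map_add, h.eta_adaptedCov,
            isSmoothForm_mvfderiv_add h.eta_smooth hY hZ]
          simp only [map_add, Pi.add_apply, area, Complex.add_re,
            Complex.add_im]
          ring
        · simp only [add_apply, map_add, h.theta_adaptedCov,
            isSmoothForm_mvfderiv_add h.theta_smooth hY hZ]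
          simp only [map_add, Pi.add_apply, Complex.ofReal_add]
          ring
      leibniz := by
        intro Y a x hY ha _
        ext v
        apply h.eq_of_forms
        · simp only [add_apply, map_add, h.eta_adaptedCov, ContinuousLinearMap.smulRight_apply,
            isSmoothForm_mvfderiv_smul h.eta_smooth ha hY]
          simp only [h.eta_adaptedCov, Pi.smul_apply', area, map_smul,
            smul_apply, smul_eq_mul, Complex.real_smul, Complex.re_ofReal_mul,
            Complex.im_ofReal_mul]
          ring
        · simp only [add_apply, map_add, h.theta_adaptedCov, ContinuousLinearMap.smulRight_apply,
            isSmoothForm_mvfderiv_smul h.theta_smooth ha hY]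
          simp only [h.theta_adaptedCov, Pi.smul_apply', map_smul,
            smul_apply, smul_eq_mul, Complex.real_smul, Complex.ofReal_mul]
          ring }
  torsion_free := by
    intro X Y x hX hY
    apply h.eq_of_forms
    · have := h.d_eta X Y x hX hY
      rw [formDeriv] at this
      rw [map_sub, h.eta_adaptedCov, h.eta_adaptedCov]
      simp only [area] at *
      linarith
    · have := h.d_theta X Y x hX hY
      rw [formDeriv] at this
      rw [map_sub, h.theta_adaptedCov, h.theta_adaptedCov]
      linear_combination this
  metric := by
    intro Y Z x v hY hZ
    have e1 : (fun y => g y (Y y) (Z y)) = (fun y => η y (Y y)) * (fun y => η y (Z y)) +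
        ((fun y => (Θ y (Y y)).re) * (fun y => (Θ y (Z y)).re) +
          (fun y => (Θ y (Y y)).im) * (fun y => (Θ y (Z y)).im)) := by
      ext y
      simp [h.metric_apply]
    have y1 := h.eta_smooth.mdifferentiableAt Y x hY
    have z1 := h.eta_smooth.mdifferentiableAt Z x hZ
    have y2 := h.theta_smooth.mdifferentiableAt Y x hY
    have z2 := h.theta_smooth.mdifferentiableAt Z x hZ
    have y3 : MDiffAt (fun y => (Θ y (Y y)).re) x := y2.clm_comp_fun Complex.reCLM
    have z3 : MDiffAt (fun y => (Θ y (Z y)).re) x := z2.clm_comp_fun Complex.reCLM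
    have y4 : MDiffAt (fun y => (Θ y (Y y)).im) x := y2.clm_comp_fun Complex.imCLM
    have z4 : MDiffAt (fun y => (Θ y (Z y)).im) x := z2.clm_comp_fun Complex.imCLM
    have y5 := mvfderiv_clm_comp Complex.reCLM y2 v
    have z5 := mvfderiv_clm_comp Complex.reCLM z2 v
    have y6 := mvfderiv_clm_comp Complex.imCLM y2 v
    have z6 := mvfderiv_clm_comp Complex.imCLM z2 v
    simp only [Complex.reCLM_apply, Complex.imCLM_apply] at y5 z5 y6 z6
    rw [e1, mvfderiv_add (y1.mul z1) ((y3.mul z3).add (y4.mul z4)),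
      mvfderiv_add (y3.mul z3) (y4.mul z4), mvfderiv_mul y1 z1, mvfderiv_mul y3 z3,
      mvfderiv_mul y4 z4]
    simp only [add_apply, smul_apply, smul_eq_mul, y5, z5, y6, z6, h.metric_apply,
      h.eta_adaptedCov, h.theta_adaptedCov, area]
    simp
    ring

/-- The explicit connection shows that the choice in `leviCivita` is not vacuous, and uniqueness
then identifies the two on differentiable fields. -/
lemma leviCivita_apply {Y : Π x : M, TangentSpace I x} {x : M} (hY : MDiffAt (T% Y) x) :
    leviCivita I g Y x = adaptedCov ξ e f η Θ α Y x :=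
  IsLeviCivita.apply_eq (Classical.epsilon_spec ⟨_, h.isLeviCivita⟩) h.isLeviCivita
    h.metric_symm h.eq_zero_of_metric h.exists_field_eq hY

end IsAdaptedCoframe

end AdaptedCoframe

end RiemannianFoliation

namespace RiemannianFoliation

namespace IsAdaptedCoframe

open Set Filter Topology VectorField

variable {E : Type*} [NormedAddCommGroup E] [NormedSpace ℝ E]
  {H : Type*} [TopologicalSpace H] {I : ModelWithCorners ℝ E H}
  {M : Type*} [TopologicalSpace M] [ChartedSpace H M] [IsManifold I ∞ M]
  {g : Π x : M, LinearMap.BilinForm ℝ (TangentSpace I x)}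
  {L : Π x : M, Submodule ℝ (TangentSpace I x)} {ξ e f : Π x : M, TangentSpace I x}
  {η : Π x : M, TangentSpace I x →L[ℝ] ℝ} {Θ : Π x : M, TangentSpace I x →L[ℝ] ℂ}
  {α : Π x : M, TangentSpace I x →L[ℝ] ℝ} {κ : M → ℝ}

omit [IsManifold I ∞ M] in
lemma mvfderiv_congr_of_eventuallyEq {F : Type*} [NormedAddCommGroup F] [NormedSpace ℝ F]
    {k k' : M → F} {x : M} (hk : k =ᶠ[𝓝 x] k') : mvfderiv I k x = mvfderiv I k' x := by
  ext v
  change mfderiv I 𝓘(ℝ, F) k x v = mfderiv I 𝓘(ℝ, F) k' x v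
  rw [hk.mfderiv_eq]
  rfl

/-! #### Sections of the normal bundle -/

/-- A section of the normal bundle as a complex function. -/
def coef (g : Π x : M, LinearMap.BilinForm ℝ (TangentSpace I x))
    (L : Π x : M, Submodule ℝ (TangentSpace I x)) (Θ : Π x : M, TangentSpace I x →L[ℝ] ℂ)
    (s : Π x : M, TangentSpace I x ⧸ L x) (x : M) : ℂ :=
  Θ x (normalLift I g L s x)

variable (h : IsAdaptedCoframe g L ξ e f η Θ α κ)

include h

/-- Since the leaf direction is `ker Θ`, the form descends injectively to the normal bundle; this is
why sections can be handled as complex functions. -/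
lemma mkQ_eq_mkQ_iff (x : M) (u v : TangentSpace I x) :
    (L x).mkQ u = (L x).mkQ v ↔ Θ x u = Θ x v := by
  rw [Submodule.mkQ_apply, Submodule.mkQ_apply, Submodule.Quotient.eq, h.mem_leaf, map_sub,
    sub_eq_zero]

lemma normalLift_spec (s : Π x : M, TangentSpace I x ⧸ L x) (x : M) :
    (L x).mkQ (normalLift I g L s x) = s x ∧ ∀ u ∈ L x, g x (normalLift I g L s x) u = 0 := by
  refine Classical.epsilon_spec (p := fun v : TangentSpace I x =>
    (L x).mkQ v = s x ∧ ∀ u ∈ L x, g x v u = 0) ?_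
  obtain ⟨v, hv⟩ := (L x).mkQ_surjective (s x)
  refine ⟨v - η x v • ξ x, ?_, fun u hu => ?_⟩
  · rw [← hv, h.mkQ_eq_mkQ_iff]
    simp [h.theta_xi]
  · rw [h.metric_apply, (h.mem_leaf x u).1 hu]
    simp [h.eta_xi]

lemma eta_normalLift (s : Π x : M, TangentSpace I x ⧸ L x) (x : M) :
    η x (normalLift I g L s x) = 0 := by
  have := (h.normalLift_spec s x).2 (ξ x) ((h.mem_leaf x _).2 (h.theta_xi x))
  rw [h.metric_apply, h.eta_xi, h.theta_xi] at this
  simpa using this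

lemma coef_eq {s : Π x : M, TangentSpace I x ⧸ L x} {x : M} {v : TangentSpace I x}
    (hv : (L x).mkQ v = s x) : coef g L Θ s x = Θ x v := by
  rw [coef, ← h.mkQ_eq_mkQ_iff, (h.normalLift_spec s x).1, hv]

lemma coef_toNormal (X : Π x : M, TangentSpace I x) (x : M) :
    coef g L Θ (toNormal I L X) x = Θ x (X x) :=
  h.coef_eq rfl

lemma coef_sub (s t : Π x : M, TangentSpace I x ⧸ L x) (x : M) :
    coef g L Θ (s - t) x = coef g L Θ s x - coef g L Θ t x := by
  rw [h.coef_eq (v := normalLift I g L s x - normalLift I g L t x), map_sub, coef, coef]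
  rw [map_sub, (h.normalLift_spec s x).1, (h.normalLift_spec t x).1, Pi.sub_apply]

/-- This reduces the regularity of the chosen lift to that of its complex coefficient. -/
lemma normalLift_eq_frameField (s : Π x : M, TangentSpace I x ⧸ L x) :
    normalLift I g L s = frameField ξ e f 0 (coef g L Θ s) := by
  ext x
  apply h.eq_of_forms
  · rw [h.eta_normalLift, h.eta_frameField, Pi.zero_apply]
  · rw [h.theta_frameField, coef]

lemma transverseMetric_apply (s t : Π x : M, TangentSpace I x ⧸ L x) (x : M) :
    transverseMetric I g L s t x = (coef g L Θ s x).re * (coef g L Θ t x).re +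
      (coef g L Θ s x).im * (coef g L Θ t x).im := by
  rw [transverseMetric, h.metric_apply, h.eta_normalLift, zero_mul, zero_add, coef, coef]

lemma mdifferentiableAt_normalLift {s : Π x : M, TangentSpace I x ⧸ L x} {x : M}
    (hs : MDifferentiableAt I 𝓘(ℝ, ℂ) (coef g L Θ s) x) :
    MDiffAt (T% (normalLift I g L s)) x := by
  rw [h.normalLift_eq_frameField]
  exact h.mdifferentiableAt_frameField mdifferentiableAt_const hs

lemma horizontalPart_apply (X : Π x : M, TangentSpace I x) (x : M) :
    horizontalPart I g L X x = X x - η x (X x) • ξ x := by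
  apply h.eq_of_forms
  · rw [horizontalPart, h.eta_normalLift]
    simp [h.eta_xi]
  · rw [horizontalPart, ← coef, h.coef_toNormal]
    simp [h.theta_xi]

lemma leafPart_eq (X : Π x : M, TangentSpace I x) :
    leafPart I g L X = frameField ξ e f (fun x => η x (X x)) 0 := by
  ext x
  rw [leafPart, Pi.sub_apply, h.horizontalPart_apply]
  simp [frameField]

/-! #### The transverse connection and its curvature -/

/-- The transverse connection is `d + √-1 α`. -/
lemma coef_transverseConnection {X : Π x : M, TangentSpace I x}
    {s : Π x : M, TangentSpace I x ⧸ L x} {x : M} (hX : MDiffAt (T% X) x)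
    (hs : MDifferentiableAt I 𝓘(ℝ, ℂ) (coef g L Θ s) x) :
    coef g L Θ (transverseConnection I g L X s) x =
      mvfderiv I (coef g L Θ s) x (X x) + Complex.I * α x (X x) * coef g L Θ s x := by
  have hl := h.mdifferentiableAt_normalLift hs
  have hf : MDiffAt (T% (leafPart I g L X)) x := by
    rw [h.leafPart_eq]
    exact h.mdifferentiableAt_frameField (h.eta_smooth.mdifferentiableAt X x hX)
      mdifferentiableAt_const
  have hz : ∀ y, Θ y (leafPart I g L X y) = 0 := fun y => by
    rw [h.leafPart_eq, h.theta_frameField, Pi.zero_apply]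
  have h1 := h.d_theta _ _ x hf hl
  -- As `Θ` kills the leaf part `V` identically, the equation for `dΘ` becomes `Θ [V, Y] = V(Θ Y) +
  -- √-1 α(V) Θ(Y)`, the same expression as in horizontal directions.
  have e1 : (fun y => Θ y (leafPart I g L X y)) = fun _ => (0 : ℂ) := funext hz
  rw [formDeriv, e1, mvfderiv_const, hz x] at h1
  rw [h.coef_eq (map_add _ _ _), map_add, h.leviCivita_apply hl, h.theta_adaptedCov,
    h.eta_normalLift]
  have e2 : η x (horizontalPart I g L X x) = 0 := h.eta_normalLift _ _
  have e3 : X x = leafPart I g L X x + horizontalPart I g L X x := by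
    rw [leafPart, Pi.sub_apply, sub_add_cancel]
  rw [e2]
  change mvfderiv I (coef g L Θ s) x _ - _ - _ = _ at h1
  change _ + (mvfderiv I (coef g L Θ s) x _ + _) = _
  conv_rhs => rw [e3, map_add, map_add]
  change _ - _ - _ = -Complex.I * (_ * coef g L Θ s x - _) at h1
  change _ + (_ + Complex.I * (_ * coef g L Θ s x + _ + _)) = _
  simp only [zero_apply] at h1
  push_cast
  linear_combination -h1

/-- The curvature of the transverse connection is `√-1 dα`. -/
lemma coef_transverseCurvature [CompleteSpace E] {X Y : Π x : M, TangentSpace I x}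
    {s : Π x : M, TangentSpace I x ⧸ L x} {p : M} (hX : CMDiffAt ∞ (T% X) p)
    (hY : CMDiffAt ∞ (T% Y) p) (hs : ContMDiffAt I 𝓘(ℝ, ℂ) ∞ (coef g L Θ s) p) :
    coef g L Θ (transverseCurvature I g L X Y s) p =
      Complex.I * formDeriv α X Y p * coef g L Θ s p := by
  have hm : ∀ X : Π x : M, TangentSpace I x, CMDiffAt ∞ (T% X) p → MDiffAt (T% X) p :=
    fun X hX => hX.mdifferentiableAt (by simp)
  -- The formula is needed on a neighbourhood of `p`, because its result is differentiated once
  -- more.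
  have hev : ∀ X : Π x : M, TangentSpace I x, CMDiffAt ∞ (T% X) p →
      coef g L Θ (transverseConnection I g L X s) =ᶠ[𝓝 p] fun x =>
        mvfderiv I (coef g L Θ s) x (X x) + Complex.I * α x (X x) * coef g L Θ s x := by
    intro X hX
    have h1 : ∀ᶠ x in 𝓝 p, MDiffAt (T% X) x :=
      ((contMDiffAt_iff_contMDiffAt_nhds (n := 1) (by simp)).1 (hX.of_le (by norm_cast))).mono
        fun x hx => hx.mdifferentiableAt one_ne_zero
    have h2 : ∀ᶠ x in 𝓝 p, MDifferentiableAt I 𝓘(ℝ, ℂ) (coef g L Θ s) x :=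
      ((contMDiffAt_iff_contMDiffAt_nhds (n := 1) (by simp)).1 (hs.of_le (by norm_cast))).mono
        fun x hx => hx.mdifferentiableAt one_ne_zero
    filter_upwards [h1, h2] with x hx1 hx2
    exact h.coef_transverseConnection hx1 hx2
  have hs2 : ContMDiffAt I 𝓘(ℝ, ℂ) 2 (coef g L Θ s) p := hs.of_le (by norm_cast)
  have hs1 : MDifferentiableAt I 𝓘(ℝ, ℂ) (coef g L Θ s) p := hs.mdifferentiableAt (by simp)
  have hD : ∀ X : Π x : M, TangentSpace I x, CMDiffAt ∞ (T% X) p →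
      MDifferentiableAt I 𝓘(ℝ, ℂ) (coef g L Θ (transverseConnection I g L X s)) p ∧
      ∀ v, mvfderiv I (coef g L Θ (transverseConnection I g L X s)) p v =
        mvfderiv I (fun y => mvfderiv I (coef g L Θ s) y (X y)) p v +
          (α p (X p) * (Complex.I * mvfderiv I (coef g L Θ s) p v) +
            mvfderiv I (fun y => α y (X y)) p v * (Complex.I * coef g L Θ s p)) := by
    intro X hX
    have e1 : (fun x => mvfderiv I (coef g L Θ s) x (X x) +
        Complex.I * α x (X x) * coef g L Θ s x) =
        (fun x => mvfderiv I (coef g L Θ s) x (X x)) + (fun x => α x (X x)) •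
          fun x => ContinuousLinearMap.mul ℝ ℂ Complex.I (coef g L Θ s x) := by
      ext x
      simp
      ring
    have h1 : MDifferentiableAt I 𝓘(ℝ, ℂ) (fun x => mvfderiv I (coef g L Θ s) x (X x)) p :=
      MDifferentiableAt.mvfderiv_apply hs2 (hm X hX)
    have h2 := h.alpha_smooth.mdifferentiableAt X p (hm X hX)
    have h3 := hs1.clm_comp_fun (ContinuousLinearMap.mul ℝ ℂ Complex.I)
    have he := hev X hX
    rw [e1] at he
    refine ⟨(h1.add (h2.smul h3)).congr_of_eventuallyEq he, fun v => ?_⟩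
    rw [mvfderiv_congr_of_eventuallyEq he, mvfderiv_add h1 (h2.smul h3), mvfderiv_smul h2 h3]
    simp only [add_apply, smul_apply, ContinuousLinearMap.smulRight_apply,
      mvfderiv_clm_comp _ hs1]
    simp only [ContinuousLinearMap.mul_apply', Complex.real_smul]
  have hXY : MDiffAt (T% (mlieBracket I X Y)) p := by
    have : IsManifold I (minSmoothness ℝ 2) M := by
      rw [minSmoothness_of_isRCLikeNormedField]
      infer_instance
    have : IsManifold I (((2 : ℕ∞) : ℕ∞ω) + 1) M := IsManifold.of_le (n := ∞) (by norm_cast)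
    have : CMDiffAt 1 (T% (mlieBracket I X Y)) p :=
      ContMDiffAt.mlieBracket_vectorField (m := 1) (n := 2) (hX.of_le (by norm_cast))
        (hY.of_le (by norm_cast)) (by simp; norm_num)
    exact this.mdifferentiableAt one_ne_zero
  -- The bracket term removes the second derivatives of the coefficient. The quadratic terms in `α`
  -- cancel because multiplication by complex numbers commutes.
  have hb := mvfderiv_mlieBracket hs2 (hm X hX) (hm Y hY)
  rw [transverseCurvature, h.coef_sub, h.coef_sub,
    h.coef_transverseConnection (hm X hX) (hD Y hY).1,
    h.coef_transverseConnection (hm Y hY) (hD X hX).1,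
    h.coef_transverseConnection hXY hs1, (hD Y hY).2, (hD X hX).2,
    (hev X hX).eq_of_nhds, (hev Y hY).eq_of_nhds, hb, formDeriv]
  push_cast
  ring

/-- The transverse scalar curvature of a foliation with an adapted coframe. -/
theorem hasTransverseScalarCurvatureAt [CompleteSpace E] (p : M) :
    HasTransverseScalarCurvatureAt I g L 2 p (-2 * κ p) := by
  have hξ : ∀ x, ξ x ∈ L x := fun x => (h.mem_leaf x _).2 (h.theta_xi x)
  have hη : ∀ (x : M) (v : TangentSpace I x), (∀ u ∈ L x, g x v u = 0) → η x v = 0 := by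
    intro x v hv
    have := hv _ (hξ x)
    rw [h.metric_apply, h.eta_xi, h.theta_xi] at this
    simpa using this
  refine ⟨⟨![e, f], univ, isOpen_univ, mem_univ p, ?_, fun x _ => ⟨?_, ?_, ?_⟩⟩, ?_⟩
  · intro i
    fin_cases i
    · exact h.contMDiff_e.contMDiffOn
    · exact h.contMDiff_f.contMDiffOn
  · intro i u hu
    rw [h.metric_apply, (h.mem_leaf x u).1 hu]
    fin_cases i <;> simp [h.eta_e, h.eta_f]
  · intro i j
    fin_cases i <;> fin_cases j <;>
      simp [h.metric_apply, h.eta_e, h.eta_f, h.theta_e, h.theta_f]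
  · intro v hv
    have hv' : v = (Θ x v).re • e x + (Θ x v).im • f x := by
      apply h.eq_of_forms
      · simp [hη x v hv, h.eta_e, h.eta_f]
      · simp [h.theta_e, h.theta_f, Complex.re_add_im]
    rw [hv']
    exact Submodule.add_mem _ (Submodule.smul_mem _ _ (Submodule.subset_span ⟨0, rfl⟩))
      (Submodule.smul_mem _ _ (Submodule.subset_span ⟨1, rfl⟩))
  · rintro b ⟨U, hU, hpU, hb, hbU⟩
    obtain ⟨hort, hon, -⟩ := hbU p hpU
    have hsm : ∀ i, CMDiffAt ∞ (T% (b i)) p := fun i => (hb i).contMDiffAt (hU.mem_nhds hpU)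
    have hη0 : ∀ i, η p (b i p) = 0 := fun i => hη p _ (hort i)
    have hc : ∀ i, coef g L Θ (toNormal I L (b i)) = fun x => Θ x (b i x) :=
      fun i => funext (h.coef_toNormal (b i))
    -- Pairing `√-1 z` with `w` gives `area z w`. Together with `dα(b_j, b_i) = κ area(b_j, b_i)`
    -- this makes a square with a minus sign.
    have hR : ∀ i j, transverseMetric I g L
        (transverseCurvature I g L (b j) (b i) (toNormal I L (b i))) (toNormal I L (b j)) p =
        - κ p * area (Θ p (b i p)) (Θ p (b j p)) ^ 2 := by
      intro i j
      rw [h.transverseMetric_apply, h.coef_transverseCurvature (hsm j) (hsm i) (by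
        rw [hc]; exact h.theta_smooth.contMDiffAt _ p (hsm i)), h.coef_toNormal, h.coef_toNormal,
        h.d_alpha _ _ p ((hsm j).mdifferentiableAt (by simp))
          ((hsm i).mdifferentiableAt (by simp)) (hη0 j) (hη0 i)]
      simp [area]
      ring
    have hg : ∀ i j, (Θ p (b i p)).re * (Θ p (b j p)).re + (Θ p (b i p)).im * (Θ p (b j p)).im =
        if i = j then 1 else 0 := by
      intro i j
      rw [← hon i j, h.metric_apply, hη0 i, zero_mul, zero_add]
    have g00 := hg 0 0
    have g01 := hg 0 1
    have g11 := hg 1 1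
    simp only [transverseRicci, hR, Fin.sum_univ_two, area]
    simp only [if_true, Fin.isValue, zero_ne_one, if_false] at g00 g01 g11
    generalize Θ p (b 0 p) = z at *
    generalize Θ p (b 1 p) = w at *
    -- Lagrange's identity: the squared area is the Gram determinant of an orthonormal pair. The two
    -- off-diagonal terms of the double sum then give `-2κ`.
    have key : (z.re * w.im - z.im * w.re) ^ 2 = 1 := by
      linear_combination (w.re * w.re + w.im * w.im) * g00 + g11 -
        (z.re * w.re + z.im * w.im) * g01
    linear_combination (-2 * κ p) * key

end IsAdaptedCoframe

end RiemannianFoliation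

/-! ### Product and chain rules for vector-valued maps on a manifold. -/

section CLMApply

variable {E : Type*} [NormedAddCommGroup E] [NormedSpace ℝ E]
  {H : Type*} [TopologicalSpace H] {I : ModelWithCorners ℝ E H}
  {M : Type*} [TopologicalSpace M] [ChartedSpace H M]
  {F : Type*} [NormedAddCommGroup F] [NormedSpace ℝ F]
  {F' : Type*} [NormedAddCommGroup F'] [NormedSpace ℝ F']

lemma mvfderiv_clm_apply {A : M → F →L[ℝ] F'} {k : M → F} {x : M} (hA : MDiffAt A x)
    (hk : MDiffAt k x) (v : TangentSpace I x) :
    mvfderiv I (fun y => A y (k y)) x v = mvfderiv I A x v (k x) + A x (mvfderiv I k x v) := by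
  have h1 := ((isBoundedBilinearMap_apply (𝕜 := ℝ) (E := F) (F := F')).hasFDerivAt
    (A x, k x)).hasMFDerivAt
  have h2 : HasMFDerivAt I 𝓘(ℝ, (F →L[ℝ] F') × F) (fun y => (A y, k y)) x
      ((mfderiv I 𝓘(ℝ, F →L[ℝ] F') A x).prod (mfderiv I 𝓘(ℝ, F) k x)) :=
    ⟨hA.continuousAt.prodMk hk.continuousAt, hA.hasMFDerivAt.2.prodMk hk.hasMFDerivAt.2⟩
  have h3 := h1.comp x h2
  rw [mvfderiv]
  change NormedSpace.fromTangentSpace _ (mfderiv I 𝓘(ℝ, F')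
    ((fun p : (F →L[ℝ] F') × F => p.1 p.2) ∘ fun y => (A y, k y)) x v) = _
  rw [h3.mfderiv, add_comm]
  rfl

lemma mvfderiv_comp_of_differentiableAt {k : M → F} {A : F → F'} {x : M}
    (hA : DifferentiableAt ℝ A (k x)) (hk : MDiffAt k x) (v : TangentSpace I x) :
    mvfderiv I (fun y => A (k y)) x v = fderiv ℝ A (k x) (mvfderiv I k x v) := by
  have h3 := hA.hasFDerivAt.hasMFDerivAt.comp x hk.hasMFDerivAt
  rw [mvfderiv]
  change NormedSpace.fromTangentSpace _ (mfderiv I 𝓘(ℝ, F') (A ∘ k) x v) = _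
  rw [h3.mfderiv]
  rfl

end CLMApply

namespace WeightedSasakian

open Set Filter Topology VectorField RiemannianFoliation

/-! ### Vector fields and forms on the sphere -/

lemma contMDiff_val {n : ℕ∞ω} : ContMDiff (𝓡 3) 𝓘(ℝ, C2) n (Subtype.val : S3 → C2) :=
  contMDiff_coe_sphere

lemma mdifferentiableAt_val (p : S3) :
    MDifferentiableAt (𝓡 3) 𝓘(ℝ, C2) (Subtype.val : S3 → C2) p :=
  contMDiff_val.contMDiffAt.mdifferentiableAt (n := 1) one_ne_zero

lemma incl_injective (p : S3) : Function.Injective (incl p) :=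
  injective_mvfderiv_subtypeVal_sphere p

lemma exists_incl_eq_iff (p : S3) (u : C2) : (∃ v, incl p v = u) ↔ inner ℝ (p : C2) u = 0 := by
  have h := range_mvfderiv_subtypeVal (n := 3) p
  rw [← Submodule.mem_orthogonal_singleton_iff_inner_right, ← h]
  rfl

lemma contMDiffAt_incl_apply {Y : Π p : S3, TangentSpace (𝓡 3) p} {p : S3}
    (hY : ContMDiffAt (𝓡 3) (𝓡 3).tangent ∞ (T% Y) p) :
    ContMDiffAt (𝓡 3) 𝓘(ℝ, C2) ∞ (fun q => incl q (Y q)) p := by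
  have h1 : ContMDiff (𝓡 3).tangent 𝓘(ℝ, C2).tangent ∞
      (tangentMap (𝓡 3) 𝓘(ℝ, C2) (Subtype.val : S3 → C2)) :=
    (contMDiff_val (n := ∞)).contMDiff_tangentMap (by norm_cast)
  exact ((contMDiff_snd_tangentBundle_modelSpace C2 𝓘(ℝ, C2)).comp h1).contMDiffAt.comp p hY

lemma mdifferentiableAt_incl_apply {Y : Π p : S3, TangentSpace (𝓡 3) p} {p : S3}
    (hY : MDifferentiableAt (𝓡 3) (𝓡 3).tangent (T% Y) p) :
    MDifferentiableAt (𝓡 3) 𝓘(ℝ, C2) (fun q => incl q (Y q)) p :=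
  MDifferentiableAt.mvfderiv_apply (contMDiff_val.contMDiffAt) hY

/-- The restriction to the sphere of a one-form on `ℂ²`. -/
def restrictForm {F : Type*} [NormedAddCommGroup F] [NormedSpace ℝ F] (A : C2 → C2 →L[ℝ] F)
    (p : S3) : TangentSpace (𝓡 3) p →L[ℝ] F :=
  A p ∘L incl p

section RestrictForm

variable {F : Type*} [NormedAddCommGroup F] [NormedSpace ℝ F] {A : C2 → C2 →L[ℝ] F}

lemma isSmoothForm_restrictForm (hA : ∀ p : S3, ContDiffAt ℝ ∞ A p) :
    IsSmoothForm (restrictForm A) where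
  mdifferentiableAt Y p hY := by
    have h1 : MDifferentiableAt (𝓡 3) 𝓘(ℝ, C2 →L[ℝ] F) (fun q : S3 => A q) p :=
      ((hA p).differentiableAt (by simp)).mdifferentiableAt.comp p (mdifferentiableAt_val p)
    exact h1.clm_apply (mdifferentiableAt_incl_apply hY)
  contMDiffAt Y p hY := by
    have h1 : ContMDiffAt (𝓡 3) 𝓘(ℝ, C2 →L[ℝ] F) ∞ (fun q : S3 => A q) p :=
      (hA p).contMDiffAt.comp p contMDiff_val.contMDiffAt
    exact h1.clm_apply (contMDiffAt_incl_apply hY)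

/-- Exterior differentiation commutes with restriction. `mvfderiv_mlieBracket`, applied to the
inclusion itself, expresses the included bracket as a commutator, which cancels the derivatives of
the fields; no extension of them to `ℂ²` is needed. -/
lemma formDeriv_restrictForm {p : S3} (hA : DifferentiableAt ℝ A p)
    {X Y : Π p : S3, TangentSpace (𝓡 3) p}
    (hX : MDifferentiableAt (𝓡 3) (𝓡 3).tangent (T% X) p)
    (hY : MDifferentiableAt (𝓡 3) (𝓡 3).tangent (T% Y) p) :
    formDeriv (restrictForm A) X Y p =
      fderiv ℝ A p (incl p (X p)) (incl p (Y p)) - fderiv ℝ A p (incl p (Y p)) (incl p (X p)) := by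
  have h1 : MDifferentiableAt (𝓡 3) 𝓘(ℝ, C2 →L[ℝ] F) (fun q : S3 => A q) p :=
    hA.mdifferentiableAt.comp p (mdifferentiableAt_val p)
  have h2 : ∀ v, mvfderiv (𝓡 3) (fun q : S3 => A q) p v = fderiv ℝ A p (incl p v) :=
    mvfderiv_comp_of_differentiableAt hA (mdifferentiableAt_val p)
  have h3 : incl p (mlieBracket (𝓡 3) X Y p) = _ :=
    mvfderiv_mlieBracket (contMDiff_val.contMDiffAt) hX hY
  simp only [formDeriv, restrictForm, ContinuousLinearMap.comp_apply]
  rw [mvfderiv_clm_apply h1 (mdifferentiableAt_incl_apply hX),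
    mvfderiv_clm_apply h1 (mdifferentiableAt_incl_apply hY), h3, map_sub, h2, h2]
  simp only [incl]
  abel

end RestrictForm

/-! ### Smooth fields on the sphere from tangent fields on `ℂ²`. -/

/-- The vector field on the sphere given by a vector field on `ℂ²` tangent to it. -/
def tangentField (V : C2 → C2) (p : S3) : TangentSpace (𝓡 3) p :=
  Classical.epsilon fun v => incl p v = V p

lemma incl_tangentField {V : C2 → C2} {p : S3} (hV : inner ℝ (p : C2) (V p) = 0) :
    incl p (tangentField V p) = V p :=
  Classical.epsilon_spec ((exists_incl_eq_iff p _).2 hV)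

/-- The circle in the sphere through `p` with velocity `V` at `p`. -/
def greatCircle (p V : C2) (t : ℝ) : C2 :=
  (4 + t ^ 2 * ‖V‖ ^ 2)⁻¹ • ((4 - t ^ 2 * ‖V‖ ^ 2) • p + (4 * t) • V)

lemma greatCircle_zero (p V : C2) : greatCircle p V 0 = p := by
  simp [greatCircle, smul_smul]

/-- The rational parametrization involves only the squared norm of `V` and has denominator at least
4, so it stays smooth at `V = 0`. -/
lemma contDiff_greatCircle :
    ContDiff ℝ ∞ (fun x : C2 × C2 × ℝ => greatCircle x.1 x.2.1 x.2.2) := by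
  have h2 : ContDiff ℝ ∞ (fun x : C2 × C2 × ℝ => x.2.2 ^ 2 * ‖x.2.1‖ ^ 2) :=
    (contDiff_snd.snd.pow 2).mul (contDiff_snd.fst.norm_sq ℝ)
  exact ((contDiff_const.add h2).inv fun x => by positivity).smul
    (((contDiff_const.sub h2).smul contDiff_fst).add
      ((contDiff_const.mul contDiff_snd.snd).smul contDiff_snd.fst))

/-- By orthogonality this is `(4 - s)² + 16 s = (4 + s)²` with `s = t² ‖V‖²`. -/
lemma norm_greatCircle {p V : C2} (hp : ‖p‖ = 1) (hV : inner ℝ p V = 0) (t : ℝ) :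
    ‖greatCircle p V t‖ = 1 := by
  have h0 : 0 < 4 + t ^ 2 * ‖V‖ ^ 2 := by positivity
  have h1 : ‖(4 - t ^ 2 * ‖V‖ ^ 2) • p + (4 * t) • V‖ ^ 2 = (4 + t ^ 2 * ‖V‖ ^ 2) ^ 2 := by
    rw [norm_add_sq_real, norm_smul, norm_smul, inner_smul_left, inner_smul_right, hV, mul_pow,
      mul_pow, hp]
    simp only [Real.norm_eq_abs, sq_abs]
    simp
    ring
  rw [greatCircle, norm_smul, norm_inv, Real.norm_of_nonneg h0.le,
    (sq_eq_sq₀ (norm_nonneg _) h0.le).1 h1, inv_mul_cancel₀ h0.ne']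

lemma hasDerivAt_greatCircle (p V : C2) : HasDerivAt (greatCircle p V) V 0 := by
  have h2 : HasDerivAt (fun t : ℝ => t ^ 2 * ‖V‖ ^ 2) 0 0 := by
    simpa using (hasDerivAt_pow 2 (0 : ℝ)).mul_const (‖V‖ ^ 2)
  have h3 : HasDerivAt (fun t : ℝ => (4 + t ^ 2 * ‖V‖ ^ 2)⁻¹) 0 0 := by
    simpa using! (h2.const_add 4).inv (by simp)
  have h4 : HasDerivAt (fun t : ℝ => (4 - t ^ 2 * ‖V‖ ^ 2) • p) 0 0 := by
    simpa using (h2.const_sub 4).smul_const p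
  have h5 : HasDerivAt (fun t : ℝ => (4 * t) • V) ((4 : ℝ) • V) 0 := by
    simpa using ((hasDerivAt_id (0 : ℝ)).const_mul 4).smul_const V
  have h6 := h3.smul (h4.add h5)
  have h7 : greatCircle p V = (fun t : ℝ => (4 + t ^ 2 * ‖V‖ ^ 2)⁻¹) •
      ((fun t : ℝ => (4 - t ^ 2 * ‖V‖ ^ 2) • p) + fun t : ℝ => (4 * t) • V) := rfl
  rw [h7]
  simpa [smul_smul] using h6

lemma tangentBundle_mk_eq {p q : S3} {u : TangentSpace (𝓡 3) p} {v : TangentSpace (𝓡 3) q}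
    (hpq : p = q) (huv : incl p u = incl q v) :
    (⟨p, u⟩ : TangentBundle (𝓡 3) S3) = ⟨q, v⟩ := by
  subst hpq
  rw [incl_injective p huv]

/-- The field is the velocity at `t = 0` of the smooth family of circles `Φ : S³ × ℝ → S³`. As a
section it is the tangent map of `Φ` after `p ↦ ((p, 0), ∂_t)`, so it is smooth although its values
are defined by choice. -/
lemma contMDiff_tangentField {V : C2 → C2} (hV : ∀ p : S3, ContDiffAt ℝ ∞ V p)
    (hort : ∀ p : S3, inner ℝ (p : C2) (V p) = 0) :
    ContMDiff (𝓡 3) (𝓡 3).tangent ∞ (T% (tangentField V)) := by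
  have hVs : ContMDiff (𝓡 3) 𝓘(ℝ, C2) ∞ (fun p : S3 => V p) := fun p =>
    (hV p).contMDiffAt.comp p contMDiff_val.contMDiffAt
  let f : S3 × ℝ → C2 := fun x => greatCircle x.1 (V x.1) x.2
  have hf : ContMDiff ((𝓡 3).prod 𝓘(ℝ, ℝ)) 𝓘(ℝ, C2) ∞ f := by
    have h1 : ContMDiff ((𝓡 3).prod 𝓘(ℝ, ℝ)) 𝓘(ℝ, C2 × C2 × ℝ) ∞
        (fun x : S3 × ℝ => ((x.1 : C2), V x.1, x.2)) :=
      (contMDiff_val.comp contMDiff_fst).prodMk_space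
        ((hVs.comp contMDiff_fst).prodMk_space contMDiff_snd)
    have h2 : ContMDiff 𝓘(ℝ, C2 × C2 × ℝ) 𝓘(ℝ, C2) ∞
        (fun x : C2 × C2 × ℝ => greatCircle x.1 x.2.1 x.2.2) := contDiff_greatCircle.contMDiff
    have h3 := h2.comp h1
    exact h3
  have hfs : ∀ x, f x ∈ Metric.sphere (0 : C2) 1 := fun x => by
    rw [mem_sphere_zero_iff_norm]
    exact norm_greatCircle (by simp) (hort x.1) x.2
  let Φ : S3 × ℝ → S3 := Set.codRestrict f _ hfs
  have hΦ : ContMDiff ((𝓡 3).prod 𝓘(ℝ, ℝ)) (𝓡 3) ∞ Φ := ContMDiff.codRestrict_sphere hf hfs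
  have hT : ContMDiff ((𝓡 3).prod 𝓘(ℝ, ℝ)).tangent (𝓡 3).tangent ∞
      (tangentMap ((𝓡 3).prod 𝓘(ℝ, ℝ)) (𝓡 3) Φ) :=
    hΦ.contMDiff_tangentMap (by norm_cast)
  have hσ : ContMDiff (𝓡 3) ((𝓡 3).prod 𝓘(ℝ, ℝ)).tangent ∞
      (fun p : S3 => (equivTangentBundleProd (𝓡 3) S3 𝓘(ℝ, ℝ) ℝ).symm
      ((⟨p, 0⟩ : TangentBundle (𝓡 3) S3), (⟨(0 : ℝ), (1 : ℝ)⟩ : TangentBundle 𝓘(ℝ, ℝ) ℝ))) :=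
    contMDiff_equivTangentBundleProd_symm.comp
      ((Bundle.contMDiff_zeroSection ℝ (TangentSpace (𝓡 3) : S3 → Type _)).prodMk
        contMDiff_const)
  convert! hT.comp hσ using 1
  ext1 p
  symm
  have hΦ0 : Φ (p, 0) = p := Subtype.ext (greatCircle_zero _ _)
  refine tangentBundle_mk_eq hΦ0 ?_
  rw [incl_tangentField (hort p)]
  have hΦd := hΦ.mdifferentiableAt (x := (p, (0 : ℝ))) (by simp)
  have h1 := (mdifferentiableAt_val (Φ (p, 0))).hasMFDerivAt.comp (p, (0 : ℝ)) hΦd.hasMFDerivAt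
  have h2 : HasMFDerivAt 𝓘(ℝ, ℝ) ((𝓡 3).prod 𝓘(ℝ, ℝ)) (fun t : ℝ => (p, t)) 0
      (ContinuousLinearMap.inr ℝ (TangentSpace (𝓡 3) p) (TangentSpace 𝓘(ℝ, ℝ) (0 : ℝ))) :=
    (hasMFDerivAt_const p 0).prodMk (hasMFDerivAt_id 0)
  have h3 := h1.comp (0 : ℝ) h2
  -- For fixed `p` the included curve is `greatCircle p (V p)`, so uniqueness of the derivative
  -- identifies the velocity.
  have h5 : HasMFDerivAt 𝓘(ℝ, ℝ) 𝓘(ℝ, C2) (Subtype.val ∘ Φ ∘ fun t : ℝ => (p, t)) 0 _ :=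
    (hasDerivAt_greatCircle p (V p)).hasFDerivAt.hasMFDerivAt
  have h6 := congrArg (fun A => A (1 : ℝ)) (hasMFDerivAt_unique h3 h5)
  refine Eq.trans ?_ (h6.trans (one_smul ℝ (V p)))
  rfl

end WeightedSasakian

namespace WeightedSasakian

open Set Filter Topology VectorField RiemannianFoliation ComplexConjugate

/-! ### The adapted coframe of the weighted sphere -/

/-- The Reeb vector field on `ℂ²`. -/
def reebVec (a : Fin 2 → ℝ) (z : C2) : C2 := !₂[Complex.I * a 0 * z 0, Complex.I * a 1 * z 1]

/-- A generator of the complex line `ker η_a`. -/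
def horVec (z : C2) : C2 := !₂[-conj (z 1), conj (z 0)]

/-- The complex coordinate one-form `dz_i`. -/
def dz (i : Fin 2) : C2 →L[ℝ] ℂ := (EuclideanSpace.proj i : C2 →L[ℂ] ℂ).restrictScalars ℝ

/-- The one-form `∑ i, (x^i dy^i - y^i dx^i)`. -/
def liouville (z : C2) : C2 →L[ℝ] ℝ := ∑ i, ((z i).re • dy i - (z i).im • dx i)

/-- The differential of `σ`. -/
def dSigma (a : Fin 2 → ℝ) (z : C2) : C2 →L[ℝ] ℝ :=
  ∑ i, (2 * a i) • ((z i).re • dx i + (z i).im • dy i)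

/-- The complex one-form vanishing on the Reeb field and equal to `|z|²` on `horVec z`. -/
def horForm (a : Fin 2 → ℝ) (z : C2) : C2 →L[ℝ] ℂ :=
  z 0 • dz 1 - z 1 • dz 0 +
    (Complex.I * (a 0 - a 1) * (z 0 * z 1)) • (Complex.ofRealCLM ∘L contactForm a z)

/-- The form `horForm` normalized to be unitary for `g_a`. -/
def thetaForm (a : Fin 2 → ℝ) (z : C2) : C2 →L[ℝ] ℂ := (√(sigma a z))⁻¹ • horForm a z

/-- The connection form of the transverse Levi-Civita connection. -/
def alphaForm (a : Fin 2 → ℝ) (z : C2) : C2 →L[ℝ] ℝ :=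
  (-(a 0 + a 1)) • contactForm a z +
    (3 * (a 0 - a 1)) • (sigma a z)⁻¹ • (Complex.imCLM ∘L (conj (z 0 * z 1) • horForm a z))

/-- The tangent vector with components `s` and `c` along the Reeb field and `horVec`. -/
def frameVec (a : Fin 2 → ℝ) (z : C2) (s : ℝ) (c : ℂ) : C2 := s • reebVec a z + c • horVec z

variable {a : Fin 2 → ℝ} {z : C2}

/-! ### Values of the ambient forms on vectors. -/

lemma dx_apply (i : Fin 2) (u : C2) : dx i u = (u i).re := rfl

lemma dy_apply (i : Fin 2) (u : C2) : dy i u = (u i).im := rfl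

lemma dz_apply (i : Fin 2) (u : C2) : dz i u = u i := rfl

lemma liouville_apply (u : C2) :
    liouville z u = (z 0).re * (u 0).im - (z 0).im * (u 0).re +
      ((z 1).re * (u 1).im - (z 1).im * (u 1).re) := by
  simp [liouville, Fin.sum_univ_two, dx_apply, dy_apply]
  ring

lemma dSigma_apply (u : C2) :
    dSigma a z u = 2 * a 0 * ((z 0).re * (u 0).re + (z 0).im * (u 0).im) +
      2 * a 1 * ((z 1).re * (u 1).re + (z 1).im * (u 1).im) := by
  simp [dSigma, Fin.sum_univ_two, dx_apply, dy_apply]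
  ring

lemma sigma_eq : sigma a z = a 0 * ((z 0).re ^ 2 + (z 0).im ^ 2) +
    a 1 * ((z 1).re ^ 2 + (z 1).im ^ 2) := by
  simp only [sigma, Fin.sum_univ_two, ← Complex.normSq_eq_norm_sq, Complex.normSq_apply]
  ring

lemma contactForm_apply (u : C2) : contactForm a z u = (sigma a z)⁻¹ * liouville z u := rfl

lemma horForm_apply (u : C2) : horForm a z u = z 0 * u 1 - z 1 * u 0 +
    Complex.I * (a 0 - a 1) * (z 0 * z 1) * contactForm a z u := by
  simp [horForm, dz_apply]

lemma thetaForm_apply (u : C2) :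
    thetaForm a z u = ((√(sigma a z))⁻¹ : ℝ) * horForm a z u := by
  simp [thetaForm]

lemma alphaForm_apply (u : C2) :
    alphaForm a z u = -(a 0 + a 1) * contactForm a z u +
      3 * (a 0 - a 1) * ((sigma a z)⁻¹ * (conj (z 0 * z 1) * horForm a z u).im) := by
  simp [alphaForm]

/-! #### Smoothness -/

lemma contDiff_coord (i : Fin 2) {n : ℕ∞ω} : ContDiff ℝ n (fun z : C2 => z i) :=
  (dz i).contDiff

lemma hasFDerivAt_sigma : HasFDerivAt (sigma a) (dSigma a z) z := by
  have h1 : sigma a = fun z => ∑ i, a i * (dx i z ^ 2 + dy i z ^ 2) := by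
    ext z
    simp [sigma_eq, Fin.sum_univ_two, dx_apply, dy_apply]
  rw [h1]
  have h2 : HasFDerivAt (fun z => ∑ i, a i * (dx i z ^ 2 + dy i z ^ 2)) _ z :=
    HasFDerivAt.fun_sum (u := Finset.univ) fun i _ =>
      (((dx i).hasFDerivAt (x := z)).pow 2 |>.add
        (((dy i).hasFDerivAt (x := z)).pow 2)).const_mul (a i)
  convert! h2 using 1
  ext u
  simp [dSigma_apply, Fin.sum_univ_two, dx_apply, dy_apply]
  ring

lemma contDiff_sigma {n : ℕ∞ω} : ContDiff ℝ n (sigma a) :=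
  ContDiff.sum fun i _ => contDiff_const.mul ((contDiff_coord i).norm_sq ℝ)

lemma contDiff_liouville {n : ℕ∞ω} : ContDiff ℝ n liouville :=
  ContDiff.sum fun i _ => ((dx i).contDiff.smul contDiff_const).sub
    ((dy i).contDiff.smul contDiff_const)

lemma contDiffAt_contactForm {n : ℕ∞ω} (hz : sigma a z ≠ 0) :
    ContDiffAt ℝ n (contactForm a) z :=
  (contDiff_sigma.contDiffAt.inv hz).smul contDiff_liouville.contDiffAt

lemma contDiffAt_horForm {n : ℕ∞ω} (hz : sigma a z ≠ 0) : ContDiffAt ℝ n (horForm a) z := by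
  have h1 : ContDiffAt ℝ n (fun z : C2 => Complex.ofRealCLM ∘L contactForm a z) z :=
    contDiffAt_const.clm_comp (contDiffAt_contactForm hz)
  have hc := fun i => (contDiff_coord (n := n) i).contDiffAt (x := z)
  exact (((hc 0).smul contDiffAt_const).sub ((hc 1).smul contDiffAt_const)).add
    ((contDiffAt_const.mul ((hc 0).mul (hc 1))).smul h1)

lemma contDiffAt_thetaForm {n : ℕ∞ω} (hz : 0 < sigma a z) : ContDiffAt ℝ n (thetaForm a) z :=
  ((contDiff_sigma.contDiffAt.sqrt hz.ne').inv (Real.sqrt_pos.2 hz).ne').smul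
    (contDiffAt_horForm hz.ne')

lemma contDiffAt_alphaForm {n : ℕ∞ω} (hz : sigma a z ≠ 0) : ContDiffAt ℝ n (alphaForm a) z := by
  have hc := fun i => (contDiff_coord (n := n) i).contDiffAt (x := z)
  have h1 : ContDiffAt ℝ n (fun z : C2 => conj (z 0 * z 1)) z :=
    Complex.conjCLE.contDiff.contDiffAt.comp z ((hc 0).mul (hc 1))
  have h2 : ContDiffAt ℝ n
      (fun z : C2 => Complex.imCLM ∘L (conj (z 0 * z 1) • horForm a z)) z := by
    have h3 : ContDiffAt ℝ n (fun z : C2 => conj (z 0 * z 1) • horForm a z) z :=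
      h1.smul (contDiffAt_horForm hz)
    exact contDiffAt_const.clm_comp h3
  exact ((contDiffAt_contactForm hz).const_smul _).add
    (((contDiff_sigma.contDiffAt.inv hz).smul h2).const_smul _)

/-! #### Derivatives -/

/-- Freezing the argument `v` reduces the derivative of a form to that of an `F`-valued function. -/
lemma fderiv_apply_eq {F : Type*} [NormedAddCommGroup F] [NormedSpace ℝ F]
    {A : C2 → C2 →L[ℝ] F} (hA : DifferentiableAt ℝ A z) {v : C2} {k : C2 → F} {D : C2 →L[ℝ] F}
    (hk : ∀ w, A w v = k w) (hD : HasFDerivAt k D z) (u : C2) : fderiv ℝ A z u v = D u := by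
  have h1 := hA.hasFDerivAt.clm_apply (hasFDerivAt_const v z)
  simp only [hk] at h1
  rw [hD.unique h1]
  simp

lemma hasFDerivAt_form_apply {F : Type*} [NormedAddCommGroup F] [NormedSpace ℝ F]
    {A : C2 → C2 →L[ℝ] F} (hA : DifferentiableAt ℝ A z) (v : C2) :
    HasFDerivAt (fun w => A w v) ((fderiv ℝ A z).flip v) z := by
  have h1 := hA.hasFDerivAt.clm_apply (hasFDerivAt_const v z)
  convert! h1 using 1
  ext u
  simp

lemma hasFDerivAt_sigma_inv (hz : sigma a z ≠ 0) :
    HasFDerivAt (fun w => (sigma a w)⁻¹) (-((sigma a z) ^ 2)⁻¹ • dSigma a z) z :=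
  (hasDerivAt_inv hz).comp_hasFDerivAt z hasFDerivAt_sigma

lemma fderiv_contactForm (hz : sigma a z ≠ 0) (u v : C2) :
    fderiv ℝ (contactForm a) z u v =
      -((sigma a z) ^ 2)⁻¹ * dSigma a z u * liouville z v + (sigma a z)⁻¹ * liouville u v := by
  -- The pairing is bilinear and skew, so as a function of its base point it is linear.
  have h1 : HasFDerivAt (fun w : C2 => liouville w v) (-liouville v) z := by
    have : (fun w : C2 => liouville w v) = fun w => (-liouville v) w := by
      ext w
      simp only [neg_apply, liouville_apply]
      ring
    rw [this]
    exact (-liouville v).hasFDerivAt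
  rw [fderiv_apply_eq ((contDiffAt_contactForm (n := 1) hz).differentiableAt one_ne_zero)
    (fun w => contactForm_apply v) ((hasFDerivAt_sigma_inv hz).mul h1)]
  simp [liouville_apply]
  ring

lemma hasFDerivAt_coord (i : Fin 2) : HasFDerivAt (fun w : C2 => w i) (dz i) z :=
  (dz i).hasFDerivAt

lemma fderiv_horForm (hz : sigma a z ≠ 0) (u v : C2) :
    fderiv ℝ (horForm a) z u v = u 0 * v 1 - u 1 * v 0 +
      Complex.I * (a 0 - a 1) * ((z 0 * u 1 + z 1 * u 0) * contactForm a z v +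
        z 0 * z 1 * fderiv ℝ (contactForm a) z u v) := by
  have h1 := Complex.ofRealCLM.hasFDerivAt.comp z (hasFDerivAt_form_apply
    ((contDiffAt_contactForm (n := 1) hz).differentiableAt one_ne_zero) v)
  have h2 := ((hasFDerivAt_coord (z := z) 0).mul (hasFDerivAt_coord 1)).const_mul
    (Complex.I * (a 0 - a 1))
  have h3 := (((hasFDerivAt_coord (z := z) 0).mul_const (v 1)).sub
    ((hasFDerivAt_coord (z := z) 1).mul_const (v 0))).add (h2.mul h1)
  rw [fderiv_apply_eq ((contDiffAt_horForm (n := 1) hz).differentiableAt one_ne_zero)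
    (fun w => horForm_apply v) h3]
  simp [dz_apply]
  ring

lemma fderiv_thetaForm (hz : 0 < sigma a z) (u v : C2) :
    fderiv ℝ (thetaForm a) z u v = ((√(sigma a z))⁻¹ : ℝ) *
      (fderiv ℝ (horForm a) z u v - ((2 * sigma a z)⁻¹ * dSigma a z u : ℝ) * horForm a z v) := by
  have hs := Real.sqrt_pos.2 hz
  have h1 := hasFDerivAt_form_apply
    ((contDiffAt_horForm (n := 1) hz.ne').differentiableAt one_ne_zero) v
  have h2 := (hasDerivAt_inv hs.ne').comp_hasFDerivAt z
    ((hasFDerivAt_sigma (a := a) (z := z)).sqrt hz.ne')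
  rw [fderiv_apply_eq ((contDiffAt_thetaForm (n := 1) hz).differentiableAt one_ne_zero)
    (fun w => rfl) (h2.smul h1)]
  simp [Real.sq_sqrt hz.le]
  field_simp
  ring

lemma fderiv_alphaForm (hz : sigma a z ≠ 0) (u v : C2) :
    fderiv ℝ (alphaForm a) z u v = -(a 0 + a 1) * fderiv ℝ (contactForm a) z u v +
      3 * (a 0 - a 1) * (-((sigma a z) ^ 2)⁻¹ * dSigma a z u *
          (conj (z 0 * z 1) * horForm a z v).im +
        (sigma a z)⁻¹ * (conj (z 0 * u 1 + z 1 * u 0) * horForm a z v +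
          conj (z 0 * z 1) * fderiv ℝ (horForm a) z u v).im) := by
  have h1 := hasFDerivAt_form_apply
    ((contDiffAt_horForm (n := 1) hz).differentiableAt one_ne_zero) v
  have h2 := Complex.conjCLE.toContinuousLinearMap.hasFDerivAt.comp z
    ((hasFDerivAt_coord (z := z) 0).mul (hasFDerivAt_coord 1))
  have h3 := ((hasFDerivAt_sigma_inv hz).mul
    (Complex.imCLM.hasFDerivAt.comp z (h2.mul h1))).const_mul (3 * (a 0 - a 1))
  have h4 := ((hasFDerivAt_form_apply
    ((contDiffAt_contactForm (n := 1) hz).differentiableAt one_ne_zero) v).const_mul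
      (-(a 0 + a 1))).add h3
  rw [fderiv_apply_eq ((contDiffAt_alphaForm (n := 1) hz).differentiableAt one_ne_zero)
    (fun w => alphaForm_apply v) h4]
  simp [dz_apply]
  ring

/-! #### The coframe on frame vectors -/

lemma frameVec_zero (s : ℝ) (c : ℂ) :
    frameVec a z s c 0 = Complex.I * a 0 * z 0 * s - c * conj (z 1) := by
  simp [frameVec, reebVec, horVec]
  ring

lemma frameVec_one (s : ℝ) (c : ℂ) :
    frameVec a z s c 1 = Complex.I * a 1 * z 1 * s + c * conj (z 0) := by
  simp [frameVec, reebVec, horVec]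
  ring

lemma liouville_frameVec (s : ℝ) (c : ℂ) : liouville z (frameVec a z s c) = sigma a z * s := by
  simp [liouville_apply, frameVec_zero, frameVec_one, sigma_eq]
  ring

lemma dSigma_frameVec (s : ℝ) (c : ℂ) :
    dSigma a z (frameVec a z s c) = -2 * (a 0 - a 1) * (c * conj (z 0 * z 1)).re := by
  simp [dSigma_apply, frameVec_zero, frameVec_one]
  ring

lemma contactForm_frameVec (hz : sigma a z ≠ 0) (s : ℝ) (c : ℂ) :
    contactForm a z (frameVec a z s c) = s := by
  rw [contactForm_apply, liouville_frameVec, inv_mul_cancel_left₀ hz]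

/-- On the Reeb vector `z₁ dz₂ - z₂ dz₁` equals `-√-1 (a₁ - a₂) z₁ z₂`, which the correction term
cancels. On `c • horVec z` it gives `c |z|²`. -/
lemma horForm_frameVec (hz : sigma a z ≠ 0) (hn : z 0 * conj (z 0) + z 1 * conj (z 1) = 1)
    (s : ℝ) (c : ℂ) : horForm a z (frameVec a z s c) = c := by
  rw [horForm_apply, contactForm_frameVec hz, frameVec_zero, frameVec_one]
  linear_combination c * hn

lemma thetaForm_frameVec (hz : sigma a z ≠ 0) (hn : z 0 * conj (z 0) + z 1 * conj (z 1) = 1)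
    (s : ℝ) (c : ℂ) : thetaForm a z (frameVec a z s c) = ((√(sigma a z))⁻¹ : ℝ) * c := by
  rw [thetaForm_apply, horForm_frameVec hz hn]

lemma alphaForm_frameVec (hz : sigma a z ≠ 0) (hn : z 0 * conj (z 0) + z 1 * conj (z 1) = 1)
    (s : ℝ) (c : ℂ) : alphaForm a z (frameVec a z s c) =
      -(a 0 + a 1) * s + 3 * (a 0 - a 1) * ((sigma a z)⁻¹ * (conj (z 0 * z 1) * c).im) := by
  rw [alphaForm_apply, contactForm_frameVec hz, horForm_frameVec hz hn]

lemma ofReal_sigma : (sigma a z : ℂ) = a 0 * (z 0 * conj (z 0)) + a 1 * (z 1 * conj (z 1)) := by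
  simp [sigma, Fin.sum_univ_two, Complex.mul_conj, Complex.normSq_eq_norm_sq]

lemma conj_mul_add_eq_of_inner_eq_zero {u : C2} (hu : inner ℝ z u = 0) :
    conj (z 0) * u 0 + conj (z 1) * u 1 = Complex.I * liouville z u := by
  simp only [PiLp.inner_apply, Complex.inner, Fin.sum_univ_two] at hu
  have hu' : (u 0).re * (z 0).re + (u 0).im * (z 0).im +
      ((u 1).re * (z 1).re + (u 1).im * (z 1).im) = 0 := by
    simpa using hu
  apply Complex.ext
  · simp
    linarith
  · simp [liouville_apply]
    ring

/-- On the unit sphere `z` and `horVec z` form a unitary basis of `ℂ²`. Tangency makes the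
coefficient of `u` along `z` purely imaginary, and it equals `√-1 σ η(u)`. -/
lemma eq_frameVec (hz : sigma a z ≠ 0) (hn : z 0 * conj (z 0) + z 1 * conj (z 1) = 1) {u : C2}
    (hu : inner ℝ z u = 0) : u = frameVec a z (contactForm a z u) (horForm a z u) := by
  have h1 : conj (z 0) * u 0 + conj (z 1) * u 1 =
      Complex.I * (sigma a z * contactForm a z u : ℝ) := by
    rw [conj_mul_add_eq_of_inner_eq_zero hu, contactForm_apply, mul_inv_cancel_left₀ hz]
  rw [Complex.ofReal_mul, ofReal_sigma] at h1
  ext i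
  fin_cases i
  · simp only [Fin.zero_eta, frameVec_zero, horForm_apply]
    linear_combination (-u 0 + Complex.I * a 0 * z 0 * contactForm a z u) * hn + z 0 * h1
  · simp only [Fin.mk_one, frameVec_one, horForm_apply]
    linear_combination (-u 1 + Complex.I * a 1 * z 1 * contactForm a z u) * hn + z 1 * h1

/-! #### The structure equations -/

/-- The Reeb vector is Hamiltonian for `σ`: pairing it with `u` gives `-dσ(u)/2`. These are the
terms that cancel the derivative of `σ⁻¹` in `dη`. -/
lemma liouville_frameVec_frameVec (hn : z 0 * conj (z 0) + z 1 * conj (z 1) = 1) (s t : ℝ)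
    (c d : ℂ) : 2 * liouville (frameVec a z s c) (frameVec a z t d) =
      2 * area c d + (dSigma a z (frameVec a z s c) * t - dSigma a z (frameVec a z t d) * s) := by
  have hn' := congrArg Complex.re hn
  simp at hn'
  rw [dSigma_frameVec, dSigma_frameVec]
  simp [liouville_apply, frameVec_zero, frameVec_one, area]
  linear_combination 2 * (c.re * d.im - c.im * d.re) * hn'

lemma d_contactForm (hz : sigma a z ≠ 0) (hn : z 0 * conj (z 0) + z 1 * conj (z 1) = 1) (s t : ℝ)
    (c d : ℂ) :
    fderiv ℝ (contactForm a) z (frameVec a z s c) (frameVec a z t d) -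
      fderiv ℝ (contactForm a) z (frameVec a z t d) (frameVec a z s c) =
      2 * (sigma a z)⁻¹ * area c d := by
  have h1 := liouville_frameVec_frameVec (a := a) hn s t c d
  have h2 : liouville (frameVec a z t d) (frameVec a z s c) =
      -liouville (frameVec a z s c) (frameVec a z t d) := by
    simp only [liouville_apply]
    ring
  rw [fderiv_contactForm hz, fderiv_contactForm hz, h2, liouville_frameVec, liouville_frameVec]
  field_simp
  linear_combination h1

lemma symm_frameVec (s : ℝ) (c : ℂ) :
    z 0 * frameVec a z s c 1 + z 1 * frameVec a z s c 0 =
      Complex.I * (a 0 + a 1) * (z 0 * z 1) * s + c * (z 0 * conj (z 0) - z 1 * conj (z 1)) := by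
  rw [frameVec_zero, frameVec_one]
  ring

/-- Two horizontal vectors are complex multiples of the same vector, so `dz₁ ∧ dz₂` vanishes on
them; their only contribution comes from `dη` in the correction term. -/
lemma d_horForm (hz : sigma a z ≠ 0) (hn : z 0 * conj (z 0) + z 1 * conj (z 1) = 1) (s t : ℝ)
    (c d : ℂ) :
    fderiv ℝ (horForm a) z (frameVec a z s c) (frameVec a z t d) -
      fderiv ℝ (horForm a) z (frameVec a z t d) (frameVec a z s c) =
      Complex.I * (a 0 + a 1) * (s * d - t * c) +
        Complex.I * (a 0 - a 1) * (z 0 * z 1) * (2 * (sigma a z)⁻¹ * area c d : ℝ) := by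
  have h1 := congrArg (Complex.ofReal) (d_contactForm hz hn s t c d)
  rw [Complex.ofReal_sub] at h1
  rw [fderiv_horForm hz, fderiv_horForm hz, symm_frameVec, symm_frameVec,
    contactForm_frameVec hz, contactForm_frameVec hz, ← h1]
  simp only [frameVec_zero, frameVec_one]
  linear_combination Complex.I * (a 0 + a 1) * (s * d - t * c) * hn

lemma d_thetaForm (hz : 0 < sigma a z) (hn : z 0 * conj (z 0) + z 1 * conj (z 1) = 1) (s t : ℝ)
    (c d : ℂ) :
    fderiv ℝ (thetaForm a) z (frameVec a z s c) (frameVec a z t d) -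
      fderiv ℝ (thetaForm a) z (frameVec a z t d) (frameVec a z s c) =
      -Complex.I * (alphaForm a z (frameVec a z s c) * thetaForm a z (frameVec a z t d) -
        alphaForm a z (frameVec a z t d) * thetaForm a z (frameVec a z s c)) := by
  have h1 := d_horForm hz.ne' hn s t c d
  rw [fderiv_thetaForm hz, fderiv_thetaForm hz, alphaForm_frameVec hz.ne' hn,
    alphaForm_frameVec hz.ne' hn, thetaForm_frameVec hz.ne' hn, thetaForm_frameVec hz.ne' hn,
    horForm_frameVec hz.ne' hn, horForm_frameVec hz.ne' hn, dSigma_frameVec, dSigma_frameVec]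
  rw [← mul_sub]
  -- Every real two-form on a complex line is a multiple of `area`. Here the factor 3 of `alphaForm`
  -- is explained: one part comes from differentiating `σ^(-1/2)`, two parts from `dη` inside
  -- `d_horForm`.
  have key : ∀ q : ℂ, (c * conj q).re * d - (d * conj q).re * c = Complex.I * q * area c d ∧
      (conj q * c).im * d - (conj q * d).im * c = -(q * area c d) := by
    intro q
    constructor <;> apply Complex.ext <;> simp [area] <;> ring
  obtain ⟨k1, k2⟩ := key (z 0 * z 1)
  have hσ : (sigma a z : ℂ) ≠ 0 := by exact_mod_cast hz.ne'
  push_cast at h1 ⊢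
  have h3 : (sigma a z : ℂ) * (sigma a z : ℂ)⁻¹ = 1 := mul_inv_cancel₀ hσ
  rw [mul_inv]
  linear_combination (√(sigma a z) : ℂ)⁻¹ * (h1 + (a 0 - a 1) * (sigma a z : ℂ)⁻¹ * k1 +
    3 * Complex.I * (a 0 - a 1) * (sigma a z : ℂ)⁻¹ * k2)

/-- The coefficient of `dα` on the transverse area form. -/
def kappa (a : Fin 2 → ℝ) (z : C2) : ℝ :=
  -2 * (a 0 + a 1) + 6 * (a 0 - a 1) * (‖z 0‖ ^ 2 - ‖z 1‖ ^ 2) +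
    12 * (a 0 - a 1) ^ 2 * (sigma a z)⁻¹ * (‖z 0‖ ^ 2 * ‖z 1‖ ^ 2)

/-- The three terms of `kappa` come from `-(a₁ + a₂) dη`, from the differential of `conj (z₁ z₂)`,
and, in equal halves, from the differential of `σ⁻¹` and from `d_horForm`. -/
lemma d_alphaForm (hz : 0 < sigma a z) (hn : z 0 * conj (z 0) + z 1 * conj (z 1) = 1)
    (c d : ℂ) :
    fderiv ℝ (alphaForm a) z (frameVec a z 0 c) (frameVec a z 0 d) -
      fderiv ℝ (alphaForm a) z (frameVec a z 0 d) (frameVec a z 0 c) =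
      kappa a z * area (thetaForm a z (frameVec a z 0 c)) (thetaForm a z (frameVec a z 0 d)) := by
  have h1 := d_contactForm hz.ne' hn 0 0 c d
  have h2 := d_horForm hz.ne' hn 0 0 c d
  rw [fderiv_alphaForm hz.ne', fderiv_alphaForm hz.ne', thetaForm_frameVec hz.ne' hn,
    thetaForm_frameVec hz.ne' hn, horForm_frameVec hz.ne' hn, horForm_frameVec hz.ne' hn,
    dSigma_frameVec, dSigma_frameVec, symm_frameVec, symm_frameVec]
  generalize fderiv ℝ (contactForm a) z (frameVec a z 0 c) (frameVec a z 0 d) = A at *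
  generalize fderiv ℝ (contactForm a) z (frameVec a z 0 d) (frameVec a z 0 c) = A' at *
  generalize fderiv ℝ (horForm a) z (frameVec a z 0 c) (frameVec a z 0 d) = B at *
  generalize fderiv ℝ (horForm a) z (frameVec a z 0 d) (frameVec a z 0 c) = B' at *
  have h3 : area (((√(sigma a z))⁻¹ : ℝ) * c) (((√(sigma a z))⁻¹ : ℝ) * d) =
      (sigma a z)⁻¹ * area c d := by
    have : (√(sigma a z))⁻¹ * (√(sigma a z))⁻¹ = (sigma a z)⁻¹ := by
      rw [← mul_inv, Real.mul_self_sqrt hz.le]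
    simp only [area, Complex.re_ofReal_mul, Complex.im_ofReal_mul, ← this]
    ring
  rw [h3]
  obtain rfl := sub_eq_iff_eq_add.1 h1
  obtain rfl := sub_eq_iff_eq_add.1 h2
  simp only [kappa, ← Complex.normSq_eq_norm_sq, Complex.normSq_apply]
  simp [area]
  field_simp
  ring

end WeightedSasakian

namespace WeightedSasakian

open Set Filter Topology VectorField RiemannianFoliation ComplexConjugate

variable {a : Fin 2 → ℝ}

/-! ### The weighted Sasakian structure in the adapted coframe -/

lemma extDerivForm_apply {α : C2 → C2 →L[ℝ] ℝ} {z : C2} (hα : DifferentiableAt ℝ α z)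
    (u v : C2) :
    extDerivForm α z u v = 1 / 2 * (fderiv ℝ α z u v - fderiv ℝ α z v u) := by
  have h1 : DifferentiableAt ℝ
      (fun w => ContinuousAlternatingMap.ofSubsingleton ℝ C2 ℝ (0 : Fin 1) (α w)) z :=
    (ContinuousAlternatingMap.ofSubsingletonLIE (𝕜 := ℝ) (E := C2) (F := ℝ)
      (0 : Fin 1)).differentiable.differentiableAt.comp z hα
  have h2 : ∀ u v, fderiv ℝ (fun w => α w v) z u = fderiv ℝ α z u v := fun u v => by
    rw [(hasFDerivAt_form_apply hα v).fderiv, ContinuousLinearMap.flip_apply]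
  have h3 : extDerivForm α z u v = 1 / 2 * extDeriv
      (fun w => ContinuousAlternatingMap.ofSubsingleton ℝ C2 ℝ (0 : Fin 1) (α w)) z ![u, v] := rfl
  rw [h3, extDeriv_apply h1, Fin.sum_univ_two]
  simp [Fin.removeNth, h2, Fin.succAbove]
  ring

lemma sigma_pos (ha : ∀ i, 0 < a i) (p : S3) : 0 < sigma a p := by
  have hp : ‖(p : C2)‖ ^ 2 = 1 := by simp
  rw [EuclideanSpace.norm_sq_eq, Fin.sum_univ_two] at hp
  rw [sigma, Fin.sum_univ_two]
  have h0 := ha 0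
  have h1 := ha 1
  rcases (sq_nonneg ‖(p : C2) 0‖).eq_or_lt with h | h
  · rw [← h, zero_add] at hp
    rw [← h, hp]
    linarith
  · have := sq_nonneg ‖(p : C2) 1‖
    positivity

lemma mul_conj_add_mul_conj (p : S3) :
    (p : C2) 0 * conj ((p : C2) 0) + (p : C2) 1 * conj ((p : C2) 1) = 1 := by
  have hp : ‖(p : C2)‖ ^ 2 = 1 := by simp
  rw [EuclideanSpace.norm_sq_eq, Fin.sum_univ_two] at hp
  rw [Complex.mul_conj, Complex.mul_conj, Complex.normSq_eq_norm_sq, Complex.normSq_eq_norm_sq,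
    ← Complex.ofReal_add, hp, Complex.ofReal_one]

lemma incl_eq_frameVec (ha : ∀ i, 0 < a i) (p : S3) (u : TangentSpace (𝓡 3) p) :
    incl p u = frameVec a p (eta a p u) (horForm a p (incl p u)) :=
  eq_frameVec (sigma_pos ha p).ne' (mul_conj_add_mul_conj p)
    ((exists_incl_eq_iff p _).1 ⟨u, rfl⟩)

/-- The complex coframe form on the sphere. -/
def theta (a : Fin 2 → ℝ) (p : S3) : TangentSpace (𝓡 3) p →L[ℝ] ℂ := restrictForm (thetaForm a) p

lemma theta_apply (p : S3) (u : TangentSpace (𝓡 3) p) :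
    theta a p u = ((√(sigma a p))⁻¹ : ℝ) * horForm a p (incl p u) :=
  thetaForm_apply _

lemma eq_of_eta_eq_of_theta_eq (ha : ∀ i, 0 < a i) (p : S3) (u v : TangentSpace (𝓡 3) p)
    (h1 : eta a p u = eta a p v) (h2 : theta a p u = theta a p v) : u = v := by
  apply incl_injective p
  have h3 : (((√(sigma a p))⁻¹ : ℝ) : ℂ) ≠ 0 := by
    exact_mod_cast (inv_pos.2 (Real.sqrt_pos.2 (sigma_pos ha p))).ne'
  rw [theta_apply, theta_apply] at h2
  rw [incl_eq_frameVec ha, incl_eq_frameVec ha p v, h1, mul_left_cancel₀ h3 h2]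

/-- The vector field on the sphere with components `s` and `c`. -/
def frame (a : Fin 2 → ℝ) (s : ℝ) (c : ℂ) : Π p : S3, TangentSpace (𝓡 3) p :=
  tangentField fun z => frameVec a z s (√(sigma a z) * c)

lemma inner_frameVec (z : C2) (s : ℝ) (c : ℂ) : inner ℝ z (frameVec a z s c) = 0 := by
  simp [PiLp.inner_apply, Complex.inner, frameVec_zero, frameVec_one]
  ring

lemma incl_frame (p : S3) (s : ℝ) (c : ℂ) :
    incl p (frame a s c p) = frameVec a p s (√(sigma a p) * c) :=
  incl_tangentField (inner_frameVec _ _ _)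

lemma eta_frame (ha : ∀ i, 0 < a i) (p : S3) (s : ℝ) (c : ℂ) : eta a p (frame a s c p) = s := by
  rw [eta, ContinuousLinearMap.comp_apply, incl_frame, contactForm_frameVec (sigma_pos ha p).ne']

lemma theta_frame (ha : ∀ i, 0 < a i) (p : S3) (s : ℝ) (c : ℂ) :
    theta a p (frame a s c p) = c := by
  have h : (√(sigma a p) : ℂ) ≠ 0 := by
    exact_mod_cast (Real.sqrt_pos.2 (sigma_pos ha p)).ne'
  rw [theta_apply, incl_frame, horForm_frameVec (sigma_pos ha p).ne' (mul_conj_add_mul_conj p),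
    Complex.ofReal_inv, inv_mul_cancel_left₀ h]

lemma contMDiff_frame (ha : ∀ i, 0 < a i) (s : ℝ) (c : ℂ) :
    ContMDiff (𝓡 3) (𝓡 3).tangent ∞ (T% (frame a s c)) := by
  refine contMDiff_tangentField (fun p => ?_) fun p => inner_frameVec _ _ _
  have h1 : ContDiffAt ℝ ∞ (fun z : C2 => (√(sigma a z) : ℂ)) p :=
    Complex.ofRealCLM.contDiff.contDiffAt.comp _
      (contDiff_sigma.contDiffAt.sqrt (sigma_pos ha p).ne')
  have hc := fun i => (contDiff_coord (n := ∞) i).contDiffAt (x := (p : C2))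
  have hcc := fun i => Complex.conjCLE.contDiff.contDiffAt.comp _ (hc i)
  rw [contDiffAt_piLp]
  intro i
  fin_cases i
  · simp only [Fin.zero_eta, frameVec_zero]
    exact ((contDiffAt_const.mul (hc 0)).mul contDiffAt_const).sub
      ((h1.mul contDiffAt_const).mul (hcc 1))
  · simp only [Fin.mk_one, frameVec_one]
    exact ((contDiffAt_const.mul (hc 1)).mul contDiffAt_const).add
      ((h1.mul contDiffAt_const).mul (hcc 0))

lemma area_theta (ha : ∀ i, 0 < a i) (p : S3) (u v : TangentSpace (𝓡 3) p) :
    area (theta a p u) (theta a p v) =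
      (sigma a p)⁻¹ * area (horForm a p (incl p u)) (horForm a p (incl p v)) := by
  have : (√(sigma a p))⁻¹ * (√(sigma a p))⁻¹ = (sigma a p)⁻¹ := by
    rw [← mul_inv, Real.mul_self_sqrt (sigma_pos ha p).le]
  simp only [theta_apply, area, Complex.re_ofReal_mul, Complex.im_ofReal_mul, ← this]
  ring

lemma fderiv_contactForm_sub (ha : ∀ i, 0 < a i) (p : S3) (u v : TangentSpace (𝓡 3) p) :
    fderiv ℝ (contactForm a) p (incl p u) (incl p v) -
      fderiv ℝ (contactForm a) p (incl p v) (incl p u) =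
      2 * area (theta a p u) (theta a p v) := by
  have h1 := d_contactForm (sigma_pos ha p).ne' (mul_conj_add_mul_conj p) (eta a p u) (eta a p v)
    (horForm a p (incl p u)) (horForm a p (incl p v))
  rw [← incl_eq_frameVec ha, ← incl_eq_frameVec ha] at h1
  rw [h1, area_theta ha]
  ring

lemma dEta_apply (ha : ∀ i, 0 < a i) (p : S3) (u v : TangentSpace (𝓡 3) p) :
    dEta a p u v = area (theta a p u) (theta a p v) := by
  have h1 : dEta a p u v = extDerivForm (contactForm a) p (incl p u) (incl p v) := rfl
  rw [h1, extDerivForm_apply ((contDiffAt_contactForm (n := 1)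
    (sigma_pos ha p).ne').differentiableAt one_ne_zero), fderiv_contactForm_sub ha]
  ring

lemma reeb_eq (ha : ∀ i, 0 < a i) (p : S3) : reeb a p = frame a 1 0 p := by
  have hex : ∃ ξ : TangentSpace (𝓡 3) p, eta a p ξ = 1 ∧ ∀ v, dEta a p ξ v = 0 :=
    ⟨frame a 1 0 p, eta_frame ha p 1 0, fun v => by
      rw [dEta_apply ha, theta_frame ha]
      simp [area]⟩
  obtain ⟨h1, h2⟩ := Classical.epsilon_spec hex
  change eta a p (reeb a p) = 1 at h1
  change ∀ v, dEta a p (reeb a p) v = 0 at h2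
  -- Testing against the two horizontal frame fields reads off the imaginary and the real part of
  -- `Θ` on the Reeb vector.
  have h3 := h2 (frame a 0 1 p)
  have h4 := h2 (frame a 0 Complex.I p)
  rw [dEta_apply ha, theta_frame ha] at h3 h4
  refine eq_of_eta_eq_of_theta_eq ha p _ _ (by rw [h1, eta_frame ha]) ?_
  rw [theta_frame ha]
  apply Complex.ext
  · simpa [area] using h4
  · simpa [area] using h3

lemma I_smul_frameVec {z : C2} (c : ℂ) :
    Complex.I • frameVec a z 0 c = frameVec a z 0 (Complex.I * c) := by
  simp [frameVec, smul_smul]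

lemma theta_phi (ha : ∀ i, 0 < a i) (p : S3) (v : TangentSpace (𝓡 3) p) :
    theta a p (phi a p v) = Complex.I * theta a p v := by
  -- The distribution `ker η` is a complex line on which `Θ` is complex linear, so the ambient
  -- complex structure is multiplication by `√-1` in the coframe.
  have key : ∀ u w : TangentSpace (𝓡 3) p, eta a p u = 0 →
      (incl p w = Complex.I • incl p u ↔
        eta a p w = 0 ∧ theta a p w = Complex.I * theta a p u) := by
    intro u w hu
    have h1 : incl p (frame a 0 (Complex.I * theta a p u) p) = Complex.I • incl p u := by
      rw [incl_frame, incl_eq_frameVec ha p u, hu, I_smul_frameVec, theta_apply]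
      have h : (√(sigma a p) : ℂ) ≠ 0 := by
        exact_mod_cast (Real.sqrt_pos.2 (sigma_pos ha p)).ne'
      congr 1
      push_cast
      field_simp
    rw [← h1, (incl_injective p).eq_iff]
    constructor
    · rintro rfl
      exact ⟨eta_frame ha p _ _, theta_frame ha p _ _⟩
    · rintro ⟨h2, h3⟩
      exact eq_of_eta_eq_of_theta_eq ha p _ _ (by rw [h2, eta_frame ha])
        (by rw [h3, theta_frame ha])
  have hex : ∃ φ : TangentSpace (𝓡 3) p →ₗ[ℝ] TangentSpace (𝓡 3) p,
      φ (reeb a p) = 0 ∧ ∀ v, eta a p v = 0 → incl p (φ v) = Complex.I • incl p v := by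
    refine ⟨(Complex.reCLM ∘L theta a p).toLinearMap.smulRight (frame a 0 Complex.I p) -
      (Complex.imCLM ∘L theta a p).toLinearMap.smulRight (frame a 0 1 p), ?_, fun v hv => ?_⟩
    · simp [reeb_eq ha, theta_frame ha]
    · rw [key _ _ hv]
      constructor
      · simp [eta_frame ha]
      · apply Complex.ext <;> simp [theta_frame ha]
  obtain ⟨h1, h2⟩ := Classical.epsilon_spec hex
  change phi a p (reeb a p) = 0 at h1
  change ∀ v, eta a p v = 0 → incl p (phi a p v) = Complex.I • incl p v at h2
  have h3 : eta a p (v - eta a p v • reeb a p) = 0 := by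
    simp [reeb_eq ha, eta_frame ha]
  -- Both `φ` and `Θ` kill the Reeb vector, so the horizontal component of `v` decides.
  have h4 := ((key _ _ h3).1 (h2 _ h3)).2
  rw [map_sub, map_smul, h1, smul_zero, sub_zero] at h4
  simpa [reeb_eq ha, theta_frame ha] using h4

/-- The connection form on the sphere. -/
def alpha (a : Fin 2 → ℝ) (p : S3) : TangentSpace (𝓡 3) p →L[ℝ] ℝ := restrictForm (alphaForm a) p

theorem isAdaptedCoframe (ha : ∀ i, 0 < a i) :
    IsAdaptedCoframe (metric a) (leaves a) (frame a 1 0) (frame a 0 1) (frame a 0 Complex.I)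
      (eta a) (theta a) (alpha a) (fun p => kappa a p) where
  contMDiff_xi := contMDiff_frame ha _ _
  contMDiff_e := contMDiff_frame ha _ _
  contMDiff_f := contMDiff_frame ha _ _
  eta_smooth := isSmoothForm_restrictForm fun p => contDiffAt_contactForm (sigma_pos ha p).ne'
  theta_smooth := isSmoothForm_restrictForm fun p => contDiffAt_thetaForm (sigma_pos ha p)
  alpha_smooth := isSmoothForm_restrictForm fun p => contDiffAt_alphaForm (sigma_pos ha p).ne'
  eta_xi p := eta_frame ha p _ _
  eta_e p := eta_frame ha p _ _
  eta_f p := eta_frame ha p _ _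
  theta_xi p := theta_frame ha p _ _
  theta_e p := theta_frame ha p _ _
  theta_f p := theta_frame ha p _ _
  eq_of_forms := eq_of_eta_eq_of_theta_eq ha
  metric_apply p u v := by
    have h1 : metric a p u v = dEta a p u (phi a p v) + eta a p u * eta a p v := rfl
    -- `area z (√-1 w)` is the Euclidean inner product of `z` and `w`.
    rw [h1, dEta_apply ha, theta_phi ha]
    simp [area]
    ring
  mem_leaf p u := by
    rw [leaves, Submodule.mem_span_singleton]
    constructor
    · rintro ⟨s, rfl⟩
      simp [reeb_eq ha, theta_frame ha]
    · intro hu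
      refine ⟨eta a p u, eq_of_eta_eq_of_theta_eq ha p _ _ ?_ ?_⟩
      · simp [reeb_eq ha, eta_frame ha]
      · simp [reeb_eq ha, theta_frame ha, hu]
  d_eta X Y p hX hY :=
    (formDeriv_restrictForm ((contDiffAt_contactForm (n := 1)
      (sigma_pos ha p).ne').differentiableAt one_ne_zero) hX hY).trans
      (fderiv_contactForm_sub ha p _ _)
  d_theta X Y p hX hY := by
    refine (formDeriv_restrictForm ((contDiffAt_thetaForm (n := 1)
      (sigma_pos ha p)).differentiableAt one_ne_zero) hX hY).trans ?_
    have h1 := d_thetaForm (sigma_pos ha p) (mul_conj_add_mul_conj p) (eta a p (X p))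
      (eta a p (Y p)) (horForm a p (incl p (X p))) (horForm a p (incl p (Y p)))
    rwa [← incl_eq_frameVec ha, ← incl_eq_frameVec ha] at h1
  d_alpha X Y p hX hY hX' hY' := by
    refine (formDeriv_restrictForm ((contDiffAt_alphaForm (n := 1)
      (sigma_pos ha p).ne').differentiableAt one_ne_zero) hX hY).trans ?_
    have h1 := d_alphaForm (sigma_pos ha p) (mul_conj_add_mul_conj p)
      (horForm a p (incl p (X p))) (horForm a p (incl p (Y p)))
    have h2 := incl_eq_frameVec ha p (X p)
    have h3 := incl_eq_frameVec ha p (Y p)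
    rw [hX'] at h2
    rw [hY'] at h3
    rwa [← h2, ← h3] at h1

end WeightedSasakian

end

theorem mainTheorem4 (a : Fin 2 → ℝ) (ha : ∀ i, 0 < a i) (p : WeightedSasakian.S3) :
    RiemannianFoliation.HasTransverseScalarCurvatureAt (𝓡 3)
      (WeightedSasakian.metric a) (WeightedSasakian.leaves a) 2 p
      (-24 * (a 0 - a 1) ^ 2 * (WeightedSasakian.sigma a p)⁻¹ *
            ‖(p : WeightedSasakian.C2) 0‖ ^ 2 * ‖(p : WeightedSasakian.C2) 1‖ ^ 2
        - 16 * (a 0 - a 1) *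
            (‖(p : WeightedSasakian.C2) 0‖ ^ 2 - ‖(p : WeightedSasakian.C2) 1‖ ^ 2)
        + 8 * WeightedSasakian.sigma a p) := by
  convert (WeightedSasakian.isAdaptedCoframe ha).hasTransverseScalarCurvatureAt p using 1
  have hp : ‖(p : WeightedSasakian.C2)‖ ^ 2 = 1 := by simp
  rw [EuclideanSpace.norm_sq_eq, Fin.sum_univ_two] at hp
  have hs : WeightedSasakian.sigma a p = a 0 * ‖(p : WeightedSasakian.C2) 0‖ ^ 2 +
      a 1 * ‖(p : WeightedSasakian.C2) 1‖ ^ 2 := Fin.sum_univ_two _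
  rw [WeightedSasakian.kappa]
  -- The constant `4 (a₁ + a₂)` in `-2κ`, multiplied by `|z|² = 1`, equals `8σ - 4 (a₁ - a₂)(|z₁|² -
  -- |z₂|²)`; this changes the coefficient -12 into -16.
  linear_combination 8 * hs + 4 * (a 0 + a 1) * hp
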